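/- **Setting.** Let $g:[0,\infty)\to[0,\infty)$ be a measurable $(n+1)$-dimensional density generator, i.e. $\int_{\mathbb R^{n+1}} g(z'z)\,dz=1$. Put $g^{(n)}(q)=\int_{\mathbb R} g(q+u^2)\,du$, let $g_q(t)=g(q+t)/g^{(n)}(q)$ be the conditional generator and $F_{g_q}(s)=\int_{-\infty}^s g_q(u^2)\,du$. For $\mu,\alpha\in\mathbb R^n$ and a symmetric positive definite $n\times n$ matrix $\Omega=(\omega_{ij})$, a random vector has the skew-elliptical law $SE_n(\mu,\Omega,\alpha,g)$ if it has the density $$2|\Omega|^{-1/2}\,g^{(n)}(q(x))\,F_{g_{q(x)}}\big(\alpha'(x-\mu)\big),\qquad q(x)=(x-\mu)'\Omega^{-1}(x-\mu),\quad x\in\mathbb R^n .$$ Its skewness vector is $\delta_w=\Omega\alpha/\sqrt{1+\alpha'\Omega\alpha}$. An $n\times n$ matrix $A$ is copositive if $x'Ax\ge 0$ for all $x\ge 0$ in $\mathbb R^n$, and completely positive if $A=B'B$ for some entrywise nonnegative $m\times n$ matrix $B$. For a class $\mathcal F$ of functions $f:\mathbb R^n\to\mathbb R$, write $X\le_{\mathcal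 F}Y$ if $E[f(X)]\le E[f(Y)]$ for every $f\in\mathcal F$ for which both expectations are well defined (in $[-\infty,\infty]$). The orders $\le_{cx},\le_{sm},\le_{dcx},\le_{ccx},\le_{cp},\le_{cop}$ are obtained for the following classes, where $H_f$ is the Hessian matrix of $f$: - $cx$: all convex functions; - $sm$: all twice differentiable $f$ with $\partial^2 f/\partial x_i\partial x_j\ge0$ on $\mathbb R^n$ for all $i<j$; - $dcx$: all twice differentiable $f$ with $\partial^2 f/\partial x_i\partial x_j\ge0$ on $\mathbb R^n$ for all $i,j$; - $ccx$: all twice differentiable $f$ with $\partial^2 f/\partial x_i^2\ge0$ on $\mathbb R^n$ for all $i$; - $cp$: all twice continuously differentiable $f$ with $H_f(x)$ completely positive for all $x$; - $cop$: all twice continuously differentiable $f$ with $H_f(x)$ copositive for all $x$. **Theorem 3.2.** Let $X\sim SE_n(\mu^x,\Omega^x,\alpha^x,g)$ and $Y\sim SE_n(\mu^y,\Omega^y,\alpha^y,g)$ have skewness vectors $\delta_w^x$ and $\delta_w^y$, and suppose that $\mu^x=\mu^y$ and $\delta_w^x=\delta_w^y$. (a) If $\Omega^y-\Omega^x$ is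 positive semidefinite, then $X\le_{cx}Y$. (b) If $\omega^x_{ii}=\omega^y_{ii}$ for all $i$ and $\omega^x_{ij}\le\omega^y_{ij}$ for all $i\ne j$, then $X\le_{sm}Y$. (c) If $\omega^x_{ij}\le\omega^y_{ij}$ for all $i,j$, then $X\le_{dcx}Y$. (d) If $\omega^x_{ii}\le\omega^y_{ii}$ for all $i$ and $\omega^x_{ij}=\omega^y_{ij}$ for all $i<j$, then $X\le_{ccx}Y$. (e) If $\Omega^y-\Omega^x$ is copositive, then $X\le_{cp}Y$. (f) If $\Omega^y-\Omega^x$ is completely positive, then $X\le_{cop}Y$. -/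

import Mathlib

open MeasureTheory
open scoped Matrix ENNReal

namespace HessianOrder

noncomputable section

/-! ### Skew-elliptical distributions -/

/-- `g` is the density generator of a `d`-dimensional elliptical law: a nonnegative measurable
function on `[0, ∞)` such that `z ↦ g (z'z)` is a probability density on `ℝ^d`.
(The values of `g` at negative arguments are never used.) -/
structure IsDensityGenerator (d : ℕ) (g : ℝ → ℝ) : Prop where
  measurable : Measurable g
  nonneg : ∀ t, 0 ≤ t → 0 ≤ g t
  lintegral_eq_one : ∫⁻ z : Fin d → ℝ, ENNReal.ofReal (g (z ⬝ᵥ z)) = 1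

/-- The generator of the `n`-dimensional marginals of the `(n+1)`-dimensional spherical law with
generator `g`: `g⁽ⁿ⁾(q) = ∫ g(q + u²) du`. -/
def marginalGenerator (g : ℝ → ℝ) (q : ℝ) : ℝ≥0∞ :=
  ∫⁻ u : ℝ, ENNReal.ofReal (g (q + u ^ 2))

/-- The cdf `F_{g_q}(s) = ∫_{-∞}^s g_q(u²) du` of the univariate standard elliptical law whose
generator is the conditional generator `g_q(t) = g(q + t) / g⁽ⁿ⁾(q)`. -/
def conditionalCdf (g : ℝ → ℝ) (q s : ℝ) : ℝ≥0∞ :=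
  ∫⁻ u in Set.Iic s, ENNReal.ofReal (g (q + u ^ 2)) / marginalGenerator g q

/-- The density `2 |Ω|^{-1/2} g⁽ⁿ⁾(q(x)) F_{g_{q(x)}}(α'(x - μ))`, `q(x) = (x - μ)' Ω⁻¹ (x - μ)`,
of the law `SE_n(μ, Ω, α, g)`, where `g` is an `(n+1)`-dimensional density generator. -/
def skewEllipticalDensity {n : ℕ} (μ : Fin n → ℝ) (Ω : Matrix (Fin n) (Fin n) ℝ)
    (α : Fin n → ℝ) (g : ℝ → ℝ) (x : Fin n → ℝ) : ℝ≥0∞ :=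
  ENNReal.ofReal (2 * (√Ω.det)⁻¹) *
    marginalGenerator g ((x - μ) ⬝ᵥ (Ω⁻¹ *ᵥ (x - μ))) *
    conditionalCdf g ((x - μ) ⬝ᵥ (Ω⁻¹ *ᵥ (x - μ))) (α ⬝ᵥ (x - μ))

/-- The random vector `X` on `(S, P)` has the law `SE_n(μ, Ω, α, g)`. -/
structure IsSkewElliptical {n : ℕ} {S : Type*} [MeasurableSpace S] (P : Measure S)
    (X : S → Fin n → ℝ) (μ : Fin n → ℝ) (Ω : Matrix (Fin n) (Fin n) ℝ)
    (α : Fin n → ℝ) (g : ℝ → ℝ) : Prop where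
  generator : IsDensityGenerator (n + 1) g
  posDef : Ω.PosDef
  aemeasurable : AEMeasurable X P
  map_eq : P.map X = volume.withDensity (skewEllipticalDensity μ Ω α g)

/-- The skewness vector `δ_w = Ω α / √(1 + α' Ω α)`; it is the vector for which `X` has the
same law as `μ + δ_w |U₀| + V`, where `(U₀, V)` is centred elliptical with generator `g` and
scale matrix `diag(1, Ω - δ_w δ_w')`. In terms of the coordinatewise
scales `ω = diag(√Ω₁₁, …, √Ωₙₙ)` it is `ω δ` with `δ = Ω̄ ᾱ / √(1 + ᾱ' Ω̄ ᾱ)`,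
`Ω̄ = ω⁻¹ Ω ω⁻¹` and `ᾱ = ω α`. -/
def skewnessVector {n : ℕ} (Ω : Matrix (Fin n) (Fin n) ℝ) (α : Fin n → ℝ) : Fin n → ℝ :=
  (√(1 + α ⬝ᵥ (Ω *ᵥ α)))⁻¹ • (Ω *ᵥ α)

/-! ### Cones of matrices -/

/-- `x'Ax ≥ 0` for all `x ≥ 0`. -/
def IsCopositive {n : ℕ} (A : Matrix (Fin n) (Fin n) ℝ) : Prop :=
  ∀ x : Fin n → ℝ, (∀ i, 0 ≤ x i) → 0 ≤ x ⬝ᵥ (A *ᵥ x)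

/-- `A = B'B` for an entrywise nonnegative `m × n` matrix `B`. -/
def IsCompletelyPositive {n : ℕ} (A : Matrix (Fin n) (Fin n) ℝ) : Prop :=
  ∃ (m : ℕ) (B : Matrix (Fin m) (Fin n) ℝ), (∀ k i, 0 ≤ B k i) ∧ A = Bᵀ * B

/-! ### Classes of test functions -/

/-- `f` is twice (Fréchet) differentiable on `ℝⁿ`. -/
def TwiceDifferentiable {n : ℕ} (f : (Fin n → ℝ) → ℝ) : Prop :=
  Differentiable ℝ f ∧ Differentiable ℝ (fderiv ℝ f)

/-- The Hessian matrix, with entries `∂²f / ∂xᵢ∂xⱼ`. -/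
def hessian {n : ℕ} (f : (Fin n → ℝ) → ℝ) (x : Fin n → ℝ) : Matrix (Fin n) (Fin n) ℝ :=
  Matrix.of fun i j => fderiv ℝ (fderiv ℝ f) x (Pi.single i 1) (Pi.single j 1)

/-- Convex functions. -/
def convexFunctions (n : ℕ) : Set ((Fin n → ℝ) → ℝ) :=
  {f | ConvexOn ℝ Set.univ f}

/-- Twice differentiable supermodular functions. -/
def supermodularFunctions (n : ℕ) : Set ((Fin n → ℝ) → ℝ) :=
  {f | TwiceDifferentiable f ∧ ∀ x i j, i < j → 0 ≤ hessian f x i j}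

/-- Twice differentiable directionally convex functions. -/
def directionallyConvexFunctions (n : ℕ) : Set ((Fin n → ℝ) → ℝ) :=
  {f | TwiceDifferentiable f ∧ ∀ x i j, 0 ≤ hessian f x i j}

/-- Twice differentiable componentwise convex functions. -/
def componentwiseConvexFunctions (n : ℕ) : Set ((Fin n → ℝ) → ℝ) :=
  {f | TwiceDifferentiable f ∧ ∀ x i, 0 ≤ hessian f x i i}

/-- Twice continuously differentiable functions with completely positive Hessian. -/
def completelyPositiveFunctions (n : ℕ) : Set ((Fin n → ℝ) → ℝ) :=
  {f | ContDiff ℝ 2 f ∧ ∀ x, IsCompletelyPositive (hessian f x)}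

/-- Twice continuously differentiable functions with copositive Hessian. -/
def copositiveFunctions (n : ℕ) : Set ((Fin n → ℝ) → ℝ) :=
  {f | ContDiff ℝ 2 f ∧ ∀ x, IsCopositive (hessian f x)}

/-! ### Integral stochastic orders -/

/-- The expectation of `Z` is well defined, possibly infinite: the positive and the negative part
of `Z` do not both have infinite expectation. -/
def HasExpectation {S : Type*} [MeasurableSpace S] (P : Measure S) (Z : S → ℝ) : Prop :=
  ∫⁻ s, ENNReal.ofReal (Z s) ∂P ≠ ⊤ ∨ ∫⁻ s, ENNReal.ofReal (-Z s) ∂P ≠ ⊤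

/-- The expectation `E[Z⁺] - E[Z⁻] ∈ [-∞, ∞]`. -/
def expectation {S : Type*} [MeasurableSpace S] (P : Measure S) (Z : S → ℝ) : EReal :=
  ((∫⁻ s, ENNReal.ofReal (Z s) ∂P : ℝ≥0∞) : EReal) -
    ((∫⁻ s, ENNReal.ofReal (-Z s) ∂P : ℝ≥0∞) : EReal)

/-- `X ≤_F Y`: `E[f(X)] ≤ E[f(Y)]` for all `f ∈ F` for which both expectations are well
defined. -/
def IntegralOrder {n : ℕ} (F : Set ((Fin n → ℝ) → ℝ))
    {S : Type*} [MeasurableSpace S] (P : Measure S) (X : S → Fin n → ℝ)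
    {T : Type*} [MeasurableSpace T] (Q : Measure T) (Y : T → Fin n → ℝ) : Prop :=
  ∀ f ∈ F, HasExpectation P (fun s => f (X s)) → HasExpectation Q (fun t => f (Y t)) →
    expectation P (fun s => f (X s)) ≤ expectation Q (fun t => f (Y t))

end

end HessianOrder

open Matrix

/-! The vector `X` has the law of `μ + z δ + V` with `z = |U₀| ≥ 0`, where `(U₀, V)` is centred
elliptical with scale matrix `diag(1, Ω - δδ')` (`IsSkewElliptical.lintegral_comp`). Since `X` and
`Y` share `μ`, `δ` and `g`, it suffices to fix `z` and compare two elliptical vectors with the same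
centre and radial weight `g(z² + ·)`, whose scale matrices `S`, `T` satisfy `T - S = Ωy - Ωx`.

Write `S = MM'` and `T = M diag(l) M'`. Along the path `M diag(1 + (lᵢ - 1) sin² t) M'` from `S` to
`T`, integration by parts against a radial weight turns the derivative of the integral of `f` into a
nonnegative weight integrated against `∑ (T - S)ᵢⱼ ∂ᵢⱼf` (`integral_kernel_mul_le_of_contDiff`).
Each of the six parts thus becomes a cone duality: `T - S` pairs nonnegatively with every Hessian
that the class allows.

Two obstacles remain. For the first four classes `f` need not be `C²`; the sign conditions are
restated as second differences, which survive mollification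
(`integral_kernel_mul_le_of_hasNonnegSecondDiff`). Moreover `g` is only measurable and expectations
may be infinite; the comparison is proved for continuous compactly supported weights and then read
as an inequality between measures on the line, with negative parts moved across so that no
infinities are subtracted (`lintegral_kernel_mul_le_of_forall_integral_le`). -/

/-! ### Square roots and simultaneous diagonalization of matrices -/

theorem exists_mul_transpose_of_posSemidef {ι : Type*} [Fintype ι] [DecidableEq ι]
    {S : Matrix ι ι ℝ} (hS : S.PosSemidef) : ∃ A : Matrix ι ι ℝ, S = A * Aᵀ := by
  have h := hS.1.spectral_theorem
  set U := (hS.1.eigenvectorUnitary : Matrix ι ι ℝ)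
  refine ⟨U * diagonal (fun i => √(hS.1.eigenvalues i)), ?_⟩
  have hd : diagonal (RCLike.ofReal ∘ hS.1.eigenvalues : ι → ℝ) =
      diagonal (fun i => √(hS.1.eigenvalues i)) * diagonal (fun i => √(hS.1.eigenvalues i)) := by
    rw [diagonal_mul_diagonal]
    congr 1
    ext i
    simp [Real.mul_self_sqrt (hS.eigenvalues_nonneg i)]
  rw [Unitary.conjStarAlgAut_apply, hd] at h
  conv_lhs => rw [h]
  rw [transpose_mul, diagonal_transpose]
  simp only [U, star_eq_conjTranspose, conjTranspose_eq_transpose_of_trivial, Matrix.mul_assoc]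

/-- With `S = AA'`, diagonalize `A⁻¹ T A⁻ᵀ = U diag(l) U'` by an orthogonal `U` and take `M = AU`.
-/
theorem exists_simultaneous_diagonalization {ι : Type*} [Fintype ι] [DecidableEq ι]
    {S T : Matrix ι ι ℝ} (hS : S.PosDef) (hT : T.PosDef) :
    ∃ (M : Matrix ι ι ℝ) (l : ι → ℝ), (∀ i, 0 < l i) ∧ S = M * Mᵀ ∧
      T = M * diagonal l * Mᵀ := by
  obtain ⟨A, hA⟩ := exists_mul_transpose_of_posSemidef hS.posSemidef
  have hdet : IsUnit A.det := by
    have h := hS.det_pos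
    rw [hA, det_mul, det_transpose] at h
    exact isUnit_iff_ne_zero.2 fun h0 => by simp [h0] at h
  have hAu : IsUnit A⁻¹ := (isUnit_iff_isUnit_det _).2 (by simpa using hdet)
  have hR : (A⁻¹ * T * star A⁻¹).PosDef := (IsUnit.posDef_star_right_conjugate_iff hAu).2 hT
  have h := hR.1.spectral_theorem
  rw [Unitary.conjStarAlgAut_apply] at h
  set U := (hR.1.eigenvectorUnitary : Matrix ι ι ℝ)
  have hUU : U * star U = 1 := Unitary.coe_mul_star_self hR.1.eigenvectorUnitary
  refine ⟨A * U, hR.1.eigenvalues, hR.eigenvalues_pos, ?_, ?_⟩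
  · rw [transpose_mul, ← conjTranspose_eq_transpose_of_trivial U, ← star_eq_conjTranspose,
      Matrix.mul_assoc A, ← Matrix.mul_assoc U, hUU, Matrix.one_mul, hA]
  · rw [transpose_mul, ← conjTranspose_eq_transpose_of_trivial U, ← star_eq_conjTranspose]
    calc T = A * (A⁻¹ * T * star A⁻¹) * Aᵀ := by
          rw [star_eq_conjTranspose, conjTranspose_eq_transpose_of_trivial, transpose_nonsing_inv,
            Matrix.mul_assoc, Matrix.mul_assoc, Matrix.nonsing_inv_mul _ (by simpa using hdet),
            Matrix.mul_one, Matrix.mul_nonsing_inv_cancel_left _ _ hdet]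
      _ = _ := by
          refine (congrArg (fun X => A * X * Aᵀ) h).trans ?_
          simp only [Matrix.mul_assoc]
          rfl

/-! ### Radial kernels and integration by parts -/

/-- The measure of a compact set is an infimum of integrals of continuous compactly supported
functions, and inner regularity passes from compact to measurable sets. -/
theorem measure_le_of_forall_integral_le {μ ν : Measure ℝ} [IsLocallyFiniteMeasure μ]
    [IsLocallyFiniteMeasure ν]
    (h : ∀ k : ℝ → ℝ, Continuous k → HasCompactSupport k → 0 ≤ k → ∫ x, k x ∂μ ≤ ∫ x, k x ∂ν) :
    μ ≤ ν := by
  have hK : ∀ K : Set ℝ, IsCompact K → μ K ≤ ν K := by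
    intro K hK
    rw [hK.measure_eq_biInf_integral_hasCompactSupport μ,
      hK.measure_eq_biInf_integral_hasCompactSupport ν]
    refine iInf_mono fun k => iInf_mono fun hk => iInf_mono fun hc => iInf_mono fun h1 =>
      iInf_mono fun h0 => ENNReal.ofReal_le_ofReal (h k hk hc h0)
  refine Measure.le_iff.2 fun s hs => ?_
  rw [hs.measure_eq_iSup_isCompact (μ := μ)]
  exact iSup_le fun K => iSup_le fun hKs => iSup_le fun hKc => (hK K hKc).trans (measure_mono hKs)

/-- The tail integral of `k` serves as `K`: the gradient of `K(w'w)` is `-2 k(w'w) w`, which is what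
integration by parts needs. -/
theorem exists_antideriv_of_hasCompactSupport {k : ℝ → ℝ} (hk : Continuous k)
    (hc : HasCompactSupport k) (h0 : 0 ≤ k) :
    ∃ K : ℝ → ℝ, 0 ≤ K ∧ (∀ s, HasDerivAt K (-k s) s) ∧
      ∃ R, 0 ≤ R ∧ ∀ s, R ≤ s → K s = 0 ∧ k s = 0 := by
  obtain ⟨R, hR0, hR⟩ := hc.isCompact.isBounded.subset_closedBall_lt 0 0
  have hz : ∀ s, R + 1 ≤ s → k s = 0 := fun s hs => image_eq_zero_of_notMem_tsupport fun h => by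
    have := hR h
    rw [mem_closedBall_zero_iff, Real.norm_eq_abs] at this
    linarith [le_abs_self s]
  have hz' : ∀ s, R + 1 ≤ s → ∫ t in s..(R + 1), k t = 0 := fun s hs => by
    rw [intervalIntegral.integral_congr (g := fun _ => 0), intervalIntegral.integral_zero]
    intro t ht
    rw [Set.uIcc_of_ge hs] at ht
    exact hz t ht.1
  refine ⟨fun s => ∫ t in s..(R + 1), k t, fun s => ?_, fun s => ?_, R + 1, by linarith,
    fun s hs => ⟨hz' s hs, hz s hs⟩⟩
  · rcases le_total (R + 1) s with h | h
    · exact (hz' s h).ge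
    · exact intervalIntegral.integral_nonneg h fun t _ => h0 t
  · exact intervalIntegral.integral_hasDerivAt_left (hk.intervalIntegrable _ _)
      (hk.stronglyMeasurableAtFilter _ _) hk.continuousAt

section

variable {ι : Type*} [Fintype ι]

theorem norm_le_sqrt_dotProduct_self (w : ι → ℝ) : ‖w‖ ≤ √(w ⬝ᵥ w) := by
  refine (pi_norm_le_iff_of_nonneg (Real.sqrt_nonneg _)).2 fun i => Real.abs_le_sqrt ?_
  rw [dotProduct, sq]
  exact Finset.single_le_sum (f := fun i => w i * w i) (fun i _ => mul_self_nonneg _)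
    (Finset.mem_univ i)

theorem hasCompactSupport_comp_dotProduct_self {φ : ℝ → ℝ} {R : ℝ} (h : ∀ s, R ≤ s → φ s = 0) :
    HasCompactSupport fun w : ι → ℝ => φ (w ⬝ᵥ w) := by
  refine HasCompactSupport.intro (isCompact_closedBall 0 (√R)) fun w hw => h _ ?_
  by_contra! hlt
  exact hw (mem_closedBall_zero_iff.2
    ((norm_le_sqrt_dotProduct_self w).trans (Real.sqrt_le_sqrt hlt.le)))

theorem continuous_dotProduct_self : Continuous fun w : ι → ℝ => w ⬝ᵥ w := by
  unfold dotProduct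
  fun_prop

theorem hasFDerivAt_dotProduct_self (w : ι → ℝ) :
    HasFDerivAt (fun w : ι → ℝ => w ⬝ᵥ w)
      (∑ i, (2 * w i) • (ContinuousLinearMap.proj i : (ι → ℝ) →L[ℝ] ℝ)) w := by
  unfold dotProduct
  refine HasFDerivAt.fun_sum fun i _ => ?_
  have h := (ContinuousLinearMap.proj (R := ℝ) (φ := fun _ : ι => ℝ) i).hasFDerivAt (x := w)
  convert! h.mul h using 1
  ext v
  simp
  ring

variable [DecidableEq ι]

/-- A Stein identity for radial weights: the factor `k(w'w) wᵢ` is `-1/2` times the `i`-th partial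
derivative of `K(w'w)`, and compact support removes boundary terms. -/
theorem integral_kernel_mul_coord_mul {k K : ℝ → ℝ} {R : ℝ} (hk : Continuous k)
    (hK : ∀ s, HasDerivAt K (-k s) s) (hR : ∀ s, R ≤ s → K s = 0 ∧ k s = 0)
    {H : (ι → ℝ) → ℝ} (hH : ContDiff ℝ 1 H) (i : ι) :
    ∫ w : ι → ℝ, k (w ⬝ᵥ w) * w i * H w =
      2⁻¹ * ∫ w : ι → ℝ, K (w ⬝ᵥ w) * fderiv ℝ H w (Pi.single i 1) := by
  have hKc : Continuous K := continuous_iff_continuousAt.2 fun s => (hK s).continuousAt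
  have hd : ∀ w : ι → ℝ, HasFDerivAt (fun w : ι → ℝ => K (w ⬝ᵥ w))
      ((-k (w ⬝ᵥ w)) • ∑ i, (2 * w i) • (ContinuousLinearMap.proj i : (ι → ℝ) →L[ℝ] ℝ)) w :=
    fun w => (hK _).comp_hasFDerivAt w (hasFDerivAt_dotProduct_self w)
  have hd' : ∀ w : ι → ℝ, fderiv ℝ (fun w : ι → ℝ => K (w ⬝ᵥ w)) w (Pi.single i 1) =
      -2 * (k (w ⬝ᵥ w) * w i) := fun w => by
    rw [(hd w).fderiv]
    simp [Pi.single_apply]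
    ring
  have hq := continuous_dotProduct_self (ι := ι)
  have hsK : HasCompactSupport fun w : ι → ℝ => K (w ⬝ᵥ w) :=
    hasCompactSupport_comp_dotProduct_self fun s hs => (hR s hs).1
  have hsk : HasCompactSupport fun w : ι → ℝ => k (w ⬝ᵥ w) :=
    hasCompactSupport_comp_dotProduct_self fun s hs => (hR s hs).2
  have hH' : Continuous fun w => fderiv ℝ H w (Pi.single i 1) :=
    (hH.continuous_fderiv (by simp)).clm_apply continuous_const
  have := integral_mul_fderiv_eq_neg_fderiv_mul_of_integrable (μ := (volume : Measure (ι → ℝ)))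
    (f := fun w : ι → ℝ => K (w ⬝ᵥ w)) (g := H) (v := Pi.single i 1)
    (by
      simp_rw [hd', mul_assoc]
      refine Continuous.integrable_of_hasCompactSupport ?_ ?_
      · have := hH.continuous
        fun_prop
      · exact (hsk.mul_right (f' := fun w => w i * H w)).mul_left (f := fun _ => (-2 : ℝ)))
    (Continuous.integrable_of_hasCompactSupport (by fun_prop) hsK.mul_right)
    (Continuous.integrable_of_hasCompactSupport
      (by have := hH.continuous; fun_prop) hsK.mul_right)
    (fun w _ => (hd w).differentiableAt) (fun w _ => hH.differentiable (by simp) w)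
  rw [this]
  simp_rw [hd', mul_assoc, integral_const_mul]
  ring

theorem ContinuousLinearMap.apply_eq_sum_pi_single (L : (ι → ℝ) →L[ℝ] ℝ) (v : ι → ℝ) :
    L v = ∑ i, v i * L (Pi.single i 1) := by
  conv_lhs => rw [← Finset.univ_sum_single v]
  rw [map_sum]
  refine Finset.sum_congr rfl fun i _ => ?_
  have : (Pi.single i (v i) : ι → ℝ) = v i • Pi.single i 1 := by
    rw [← Pi.single_smul]; simp
  simp [this]

/-- Here `d` is a diagonal scaling and `e` its velocity. Applying the Stein identity in each
coordinate brings out a factor `dᵢ` by the chain rule, so only the products `eᵢ dᵢ` and the pure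
second derivatives remain. -/
theorem integral_kernel_mul_fderiv_scaling_nonneg {k K : ℝ → ℝ} {R : ℝ} (hk : Continuous k)
    (hK0 : 0 ≤ K) (hK : ∀ s, HasDerivAt K (-k s) s) (hR : ∀ s, R ≤ s → K s = 0 ∧ k s = 0)
    {F : (ι → ℝ) → ℝ} (hF : ContDiff ℝ 2 F) {d e : ι → ℝ}
    (hde : ∀ w, 0 ≤ ∑ i, e i * d i * fderiv ℝ (fderiv ℝ F) w (Pi.single i 1) (Pi.single i 1)) :
    0 ≤ ∫ w : ι → ℝ, k (w ⬝ᵥ w) * fderiv ℝ F (d * w) (e * w) := by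
  have hq := continuous_dotProduct_self (ι := ι)
  have hsK : HasCompactSupport fun w : ι → ℝ => K (w ⬝ᵥ w) :=
    hasCompactSupport_comp_dotProduct_self fun s hs => (hR s hs).1
  have hsk : HasCompactSupport fun w : ι → ℝ => k (w ⬝ᵥ w) :=
    hasCompactSupport_comp_dotProduct_self fun s hs => (hR s hs).2
  have hKc : Continuous K := continuous_iff_continuousAt.2 fun s => (hK s).continuousAt
  have hF1 : ContDiff ℝ 1 (fderiv ℝ F) := hF.fderiv_right (by norm_num)
  let D : (ι → ℝ) →L[ℝ] (ι → ℝ) :=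
    ContinuousLinearMap.pi fun i => d i • ContinuousLinearMap.proj i
  have hD : ∀ w, D w = d * w := fun w => by ext i; simp [D]
  have hH : ∀ i, ContDiff ℝ 1 fun w => fderiv ℝ F (d * w) (Pi.single i 1) := fun i => by
    simp_rw [← hD]
    exact (hF1.comp D.contDiff).clm_apply contDiff_const
  have hH' : ∀ i w, fderiv ℝ (fun w => fderiv ℝ F (d * w) (Pi.single i 1)) w (Pi.single i 1) =
      d i * fderiv ℝ (fderiv ℝ F) (d * w) (Pi.single i 1) (Pi.single i 1) := fun i w => by
    simp_rw [← hD]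
    have h1 : HasFDerivAt (fun w => fderiv ℝ F (D w)) _ w :=
      ((hF1.differentiable (by simp)) (D w)).hasFDerivAt.comp w D.hasFDerivAt
    have h2 := h1.clm_apply (hasFDerivAt_const (Pi.single i (1 : ℝ) : ι → ℝ) w)
    rw [h2.fderiv]
    have : D (Pi.single i 1) = d i • Pi.single i 1 := by
      rw [hD]; ext j; by_cases h : j = i
      · subst h; simp
      · simp [h]
    simp [this]
  have hcD : Continuous fun w : ι → ℝ => d * w := by fun_prop
  have hint : ∀ i, Integrable fun w : ι → ℝ =>
      k (w ⬝ᵥ w) * w i * fderiv ℝ F (d * w) (Pi.single i 1) := fun i => by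
    simp_rw [mul_assoc]
    refine Continuous.integrable_of_hasCompactSupport ?_ hsk.mul_right
    have := (hH i).continuous
    fun_prop
  have hint' : ∀ i, Integrable fun w : ι → ℝ => K (w ⬝ᵥ w) *
      fderiv ℝ (fun w => fderiv ℝ F (d * w) (Pi.single i 1)) w (Pi.single i 1) := fun i => by
    refine Continuous.integrable_of_hasCompactSupport ?_ hsK.mul_right
    have := ((hH i).continuous_fderiv (by simp)).clm_apply
      (continuous_const (y := (Pi.single i (1 : ℝ) : ι → ℝ)))
    fun_prop
  have h1 : ∀ w : ι → ℝ, k (w ⬝ᵥ w) * fderiv ℝ F (d * w) (e * w) =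
      ∑ i, e i * (k (w ⬝ᵥ w) * w i * fderiv ℝ F (d * w) (Pi.single i 1)) := fun w => by
    rw [ContinuousLinearMap.apply_eq_sum_pi_single, Finset.mul_sum]
    refine Finset.sum_congr rfl fun i _ => ?_
    simp only [Pi.mul_apply]
    ring
  simp_rw [h1]
  rw [integral_finsetSum _ fun i _ => (hint i).const_mul _]
  simp_rw [integral_const_mul, integral_kernel_mul_coord_mul hk hK hR (hH _)]
  simp_rw [← integral_const_mul]
  rw [← integral_finsetSum _ fun i _ => ((hint' i).const_mul _).const_mul _]
  refine integral_nonneg fun w => ?_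
  have h2 : ∑ i, e i * (2⁻¹ * (K (w ⬝ᵥ w) *
      fderiv ℝ (fun w => fderiv ℝ F (d * w) (Pi.single i 1)) w (Pi.single i 1))) =
      2⁻¹ * K (w ⬝ᵥ w) * ∑ i, e i * d i *
        fderiv ℝ (fderiv ℝ F) (d * w) (Pi.single i 1) (Pi.single i 1) := by
    rw [Finset.mul_sum]
    refine Finset.sum_congr rfl fun i _ => ?_
    rw [hH']
    ring
  simp only [Pi.zero_apply, h2]
  exact mul_nonneg (mul_nonneg (by norm_num) (hK0 _)) (hde _)

theorem integral_kernel_mul_le_integral_kernel_mul_scaling {k : ℝ → ℝ} (hk : Continuous k)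
    (hc : HasCompactSupport k) (h0 : 0 ≤ k) {F : (ι → ℝ) → ℝ} (hF : ContDiff ℝ 2 F)
    {l : ι → ℝ} (hl : ∀ i, 0 < l i)
    (hlF : ∀ w, 0 ≤ ∑ i, (l i - 1) * fderiv ℝ (fderiv ℝ F) w (Pi.single i 1) (Pi.single i 1)) :
    ∫ w : ι → ℝ, k (w ⬝ᵥ w) * F w ≤
      ∫ w : ι → ℝ, k (w ⬝ᵥ w) * F ((fun i => √(l i)) * w) := by
  obtain ⟨K, hK0, hK, R, -, hR⟩ := exists_antideriv_of_hasCompactSupport hk hc h0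
  have hq := continuous_dotProduct_self (ι := ι)
  have hsk : HasCompactSupport fun w : ι → ℝ => k (w ⬝ᵥ w) :=
    hasCompactSupport_comp_dotProduct_self fun s hs => (hR s hs).2
  have hpos : ∀ i t, 0 < Real.cos t ^ 2 + l i * Real.sin t ^ 2 := fun i t => by
    have h1 := Real.sin_sq_add_cos_sq t
    rcases (sq_nonneg (Real.sin t)).eq_or_lt' with h | h
    · rw [h] at h1 ⊢; linarith
    · have := mul_pos (hl i) h
      nlinarith [sq_nonneg (Real.cos t)]
  -- The square of `d t i` is `1 + (l i - 1) sin² t`, so `d` runs from `1` at `t = 0` to `√l` at `t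
  -- = π/2`. Half the derivative of that square is `e t i * d t i = (l i - 1) sin t cos t`, whose
  -- trigonometric factor is common to all coordinates and nonnegative on this interval.
  let d : ℝ → ι → ℝ := fun t i => √(Real.cos t ^ 2 + l i * Real.sin t ^ 2)
  let e : ℝ → ι → ℝ := fun t i => (l i - 1) * (Real.sin t * Real.cos t) / d t i
  have hdpos : ∀ t i, 0 < d t i := fun t i => Real.sqrt_pos.2 (hpos i t)
  have hdc : Continuous d := continuous_pi fun i => by simp only [d]; fun_prop
  have hec : Continuous e := continuous_pi fun i =>
    Continuous.div (by fun_prop) (by fun_prop) fun t => (hdpos t i).ne'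
  have hd : ∀ t, HasDerivAt d (e t) t := fun t => hasDerivAt_pi.2 fun i => by
    have h := (((Real.hasDerivAt_cos t).pow 2).add
      (((Real.hasDerivAt_sin t).pow 2).const_mul (l i))).sqrt (hpos i t).ne'
    convert! h using 1
    simp only [e, d, Pi.add_apply, Pi.pow_apply]
    field_simp
    ring
  have hF1 : Continuous (fderiv ℝ F) := hF.continuous_fderiv (by simp)
  let G : ℝ → (ι → ℝ) → ℝ := fun t w => k (w ⬝ᵥ w) * fderiv ℝ F (d t * w) (e t * w)
  have hGc : Continuous (Function.uncurry G) := by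
    simp only [G, Function.uncurry_def]
    refine Continuous.mul (by fun_prop) (Continuous.clm_apply (hF1.comp ?_) ?_) <;> fun_prop
  have hftc : ∀ w, ∫ t in (0)..(Real.pi / 2), G t w =
      k (w ⬝ᵥ w) * F ((fun i => √(l i)) * w) - k (w ⬝ᵥ w) * F w := fun w => by
    have h1 : ∀ t, HasDerivAt (fun t => k (w ⬝ᵥ w) * F (d t * w)) (G t w) t := fun t => by
      have h2 : HasDerivAt (fun t => d t * w) (e t * w) t := (hd t).mul_const w
      exact (((hF.differentiable (by simp)) (d t * w)).hasFDerivAt.comp_hasDerivAt t h2).const_mul _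
    rw [intervalIntegral.integral_eq_sub_of_hasDerivAt (fun t _ => h1 t)
      (Continuous.intervalIntegrable (hGc.comp (by fun_prop : Continuous fun t => (t, w))) _ _)]
    congr 3
    · simp [d]
    · ext i
      simp [d]
  have hi : ∀ c : ι → ℝ, Integrable fun w : ι → ℝ => k (w ⬝ᵥ w) * F (c * w) := fun c => by
    refine Continuous.integrable_of_hasCompactSupport ?_ hsk.mul_right
    have := hF.continuous
    fun_prop
  have hi1 : Integrable fun w : ι → ℝ => k (w ⬝ᵥ w) * F w := by
    simpa using hi 1
  rw [← sub_nonneg, ← integral_sub (hi _) hi1]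
  simp_rw [← hftc, intervalIntegral.integral_of_le (by positivity : (0 : ℝ) ≤ Real.pi / 2)]
  -- Fubini applies because `G` is jointly continuous and vanishes for `w` outside the compact
  -- support of the kernel.
  have hGi : Integrable (Function.uncurry G)
      ((volume.restrict (Set.Ioc 0 (Real.pi / 2))).prod (volume : Measure (ι → ℝ))) := by
    have hcomp : IsCompact (Set.Icc 0 (Real.pi / 2) ×ˢ tsupport fun w : ι → ℝ => k (w ⬝ᵥ w)) :=
      isCompact_Icc.prod hsk
    have h1 : IntegrableOn (Function.uncurry G) (Set.Ioc 0 (Real.pi / 2) ×ˢ Set.univ) := by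
      refine IntegrableOn.of_forall_sdiff_eq_zero (hGc.continuousOn.integrableOn_compact hcomp)
        (measurableSet_Ioc.prod MeasurableSet.univ) ?_
      rintro ⟨t, w⟩ ⟨ht, htw⟩
      have hw : w ∉ tsupport fun w : ι → ℝ => k (w ⬝ᵥ w) := fun hw =>
        htw ⟨Set.Ioc_subset_Icc_self ht.1, hw⟩
      have : k (w ⬝ᵥ w) = 0 := image_eq_zero_of_notMem_tsupport (f := fun w : ι → ℝ => k (w ⬝ᵥ w)) hw
      simp [G, this]
    rwa [IntegrableOn, Measure.volume_eq_prod, ← Measure.prod_restrict, Measure.restrict_univ] at h1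
  rw [← integral_integral_swap hGi]
  refine setIntegral_nonneg measurableSet_Ioc fun t ht => ?_
  refine integral_kernel_mul_fderiv_scaling_nonneg hk hK0 hK hR hF fun w => ?_
  have h3 : ∀ i, e t i * d t i = (Real.sin t * Real.cos t) * (l i - 1) := fun i => by
    simp only [e]
    rw [div_mul_cancel₀ _ (hdpos t i).ne', mul_comm]
  simp_rw [h3, mul_assoc, ← Finset.mul_sum, ← mul_assoc]
  have hs := Real.sin_nonneg_of_nonneg_of_le_pi ht.1.le (by linarith [ht.2, Real.pi_pos])
  have hcs := Real.cos_nonneg_of_mem_Icc ⟨by linarith [ht.1, Real.pi_pos], ht.2⟩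
  exact mul_nonneg (mul_nonneg hs hcs) (hlF w)

end

/-! ### Second differences and second derivatives -/

/-- The mixed second differences of `f` in the directions `u` and `v` are nonnegative. -/
def HasNonnegSecondDiff {E : Type*} [AddCommGroup E] [Module ℝ E] (f : E → ℝ) (u v : E) : Prop :=
  ∀ x : E, ∀ s t : ℝ, 0 ≤ s → 0 ≤ t → f (x + s • u) + f (x + t • v) ≤ f (x + s • u + t • v) + f x

section

variable {E : Type*} [NormedAddCommGroup E] [NormedSpace ℝ E]

theorem hasDerivAt_comp_add_smul {F : Type*} [NormedAddCommGroup F] [NormedSpace ℝ F]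
    {f : E → F} (hf : Differentiable ℝ f) (x u : E) (s : ℝ) :
    HasDerivAt (fun s : ℝ => f (x + s • u)) (fderiv ℝ f (x + s • u) u) s := by
  have h : HasDerivAt (fun s : ℝ => x + s • u) u s := by
    simpa using ((hasDerivAt_id s).smul_const u).const_add x
  exact (hf _).hasFDerivAt.comp_hasDerivAt s h

theorem hasDerivAt_fderiv_apply_add_smul {f : E → ℝ} (hf' : Differentiable ℝ (fderiv ℝ f))
    (x u v : E) (s : ℝ) :
    HasDerivAt (fun s : ℝ => fderiv ℝ f (x + s • u) v) (fderiv ℝ (fderiv ℝ f) (x + s • u) u v) s :=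
  by simpa using (hasDerivAt_comp_add_smul hf' x u s).clm_apply (hasDerivAt_const s v)

/-- Monotonicity is used twice, first for the `v`-derivative along `u`, then for the increment of
`f` along `v`. Continuity of the second derivative plays no role. -/
theorem hasNonnegSecondDiff_of_fderiv {f : E → ℝ} (hf : Differentiable ℝ f)
    (hf' : Differentiable ℝ (fderiv ℝ f)) {u v : E}
    (h : ∀ x, 0 ≤ fderiv ℝ (fderiv ℝ f) x u v) : HasNonnegSecondDiff f u v := by
  intro x s t hs ht
  have h1 : ∀ y, Monotone fun s : ℝ => fderiv ℝ f (y + s • u) v := fun y =>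
    monotone_of_hasDerivAt_nonneg (hasDerivAt_fderiv_apply_add_smul hf' y u v) fun s => h _
  have h2 : Monotone fun t : ℝ => f (x + s • u + t • v) - f (x + t • v) :=
    monotone_of_hasDerivAt_nonneg
      (fun t => (hasDerivAt_comp_add_smul hf (x + s • u) v t).sub
        (hasDerivAt_comp_add_smul hf x v t)) fun t => by
      have := h1 (x + t • v) hs
      simp only [zero_smul, add_zero] at this
      simp only [Pi.zero_apply, sub_nonneg]
      rwa [add_right_comm]
  have := h2 ht
  simp only [zero_smul, add_zero] at this
  linarith

/-- The increments are controlled only for nonnegative step sizes, so both derivatives are computed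
as one-sided derivatives at `0`. -/
theorem HasNonnegSecondDiff.fderiv_nonneg {f : E → ℝ} (hf : Differentiable ℝ f)
    (hf' : Differentiable ℝ (fderiv ℝ f)) {u v : E} (h : HasNonnegSecondDiff f u v) (x : E) :
    0 ≤ fderiv ℝ (fderiv ℝ f) x u v := by
  have h1 : ∀ (y : E) (s : ℝ), 0 ≤ s → fderiv ℝ f y v ≤ fderiv ℝ f (y + s • u) v := fun y s hs => by
    have hd := (hasDerivAt_comp_add_smul hf (y + s • u) v 0).sub
        (hasDerivAt_comp_add_smul hf y v 0)
    simp only [zero_smul, add_zero] at hd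
    rw [← sub_nonneg, ← hd.hasDerivWithinAt (s := Set.Ici 0) |>.derivWithin
      (uniqueDiffWithinAt_Ici 0)]
    refine MonotoneOn.derivWithin_nonneg (s := Set.Ici 0) ?_
    intro a ha b hb hab
    have := h (y + a • v) s (b - a) hs (by linarith)
    simp only [Pi.sub_apply]
    have e1 : y + a • v + (b - a) • v = y + b • v := by module
    have e2 : y + a • v + s • u + (b - a) • v = y + s • u + b • v := by module
    have e3 : y + a • v + s • u = y + s • u + a • v := by module
    rw [e1, e2, e3] at this
    linarith
  have hd := hasDerivAt_fderiv_apply_add_smul hf' x u v 0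
  simp only [zero_smul, add_zero] at hd
  rw [← hd.hasDerivWithinAt (s := Set.Ici 0) |>.derivWithin (uniqueDiffWithinAt_Ici 0)]
  refine MonotoneOn.derivWithin_nonneg (s := Set.Ici 0) ?_
  intro a ha b hb hab
  have := h1 (x + a • u) (b - a) (by linarith)
  have e1 : x + a • u + (b - a) • u = x + b • u := by module
  rwa [e1] at this

/-- The points `x + s u` and `x + t u` are convex combinations of `x` and `x + (s + t) u` with
exchanged weights; the two convexity inequalities add up. -/
theorem ConvexOn.hasNonnegSecondDiff {f : E → ℝ} (hf : ConvexOn ℝ Set.univ f) (u : E) :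
    HasNonnegSecondDiff f u u := by
  intro x s t hs ht
  rcases (add_nonneg hs ht).eq_or_lt' with h | h
  · have h1 : s = 0 := by linarith
    have h2 : t = 0 := by linarith
    simp [h1, h2]
  have key : ∀ a b, 0 ≤ a → 0 ≤ b → a + b = s + t →
      f (x + a • u) ≤ b / (s + t) * f x + a / (s + t) * f (x + s • u + t • u) := by
    intro a b ha hb hab
    have := hf.2 (Set.mem_univ x) (Set.mem_univ (x + s • u + t • u))
      (div_nonneg hb h.le) (div_nonneg ha h.le)
      (by rw [← add_div, add_comm, hab, div_self h.ne'])
    have e : (b / (s + t)) • x + (a / (s + t)) • (x + s • u + t • u) = x + a • u := by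
      rw [add_assoc, ← add_smul, smul_add, smul_smul, div_mul_cancel₀ _ h.ne', ← add_assoc,
        ← add_smul, ← add_div, add_comm b, hab, div_self h.ne', one_smul]
    rwa [e] at this
  have h1 := key s t hs ht rfl
  have h2 := key t s ht hs (add_comm _ _)
  have h3 : t / (s + t) + s / (s + t) = 1 := by rw [← add_div, add_comm, div_self h.ne']
  calc _ ≤ _ := add_le_add h1 h2
    _ = (t / (s + t) + s / (s + t)) * (f (x + s • u + t • u) + f x) := by ring
    _ = _ := by rw [h3, one_mul]

end

/-! ### Mollification -/

section

variable {E : Type*} [NormedAddCommGroup E] [NormedSpace ℝ E] [FiniteDimensional ℝ E]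
  [MeasurableSpace E] [BorelSpace E] (μ : Measure E) [μ.IsAddHaarMeasure]

open scoped Convolution

/-- The condition is a translation-invariant linear inequality, hence stable under averaging with a
nonnegative bump. -/
theorem HasNonnegSecondDiff.convolution (φ : ContDiffBump (0 : E)) {f : E → ℝ}
    (hf : Continuous f) {u v : E} (h : HasNonnegSecondDiff f u v) :
    HasNonnegSecondDiff (φ.normed μ ⋆[ContinuousLinearMap.lsmul ℝ ℝ, μ] f) u v := by
  intro x s t hs ht
  have hi : ∀ y, Integrable (fun z => φ.normed μ z * f (y - z)) μ := fun y =>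
    Continuous.integrable_of_hasCompactSupport
      (φ.continuous_normed.mul (hf.comp (by fun_prop))) φ.hasCompactSupport_normed.mul_right
  simp only [convolution_def, ContinuousLinearMap.lsmul_apply, smul_eq_mul]
  rw [← integral_add (hi _) (hi _), ← integral_add (hi _) (hi _)]
  refine integral_mono ((hi _).add (hi _)) ((hi _).add (hi _)) fun z => ?_
  have := mul_le_mul_of_nonneg_left (h (x - z) s t hs ht) (φ.nonneg_normed (μ := μ) z)
  have e : ∀ a, x - z + a = x + a - z := fun a => by abel
  rw [add_assoc, e, e, e] at this
  simp only
  rw [add_assoc x]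
  linarith

/-- A single mollifier, supported within a radius of uniform continuity near `K`, preserves the
conditions for all pairs of directions at once. -/
theorem exists_contDiff_approx {f : E → ℝ} (hf : Continuous f) {K : Set E} (hK : IsCompact K)
    {ε : ℝ} (hε : 0 < ε) :
    ∃ h : E → ℝ, ContDiff ℝ 2 h ∧ (∀ x ∈ K, |h x - f x| ≤ ε) ∧
      ∀ u v, HasNonnegSecondDiff f u v → HasNonnegSecondDiff h u v := by
  let μ : Measure E := Measure.addHaar
  have hu := hK.uniformContinuousAt_of_continuousAt f (fun a _ => hf.continuousAt)
    (Metric.dist_mem_uniformity hε)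
  obtain ⟨δ, hδ, hδf⟩ := Metric.mem_uniformity_dist.1 hu
  let φ : ContDiffBump (0 : E) := ⟨δ / 2, δ, by positivity, by linarith⟩
  refine ⟨φ.normed μ ⋆[ContinuousLinearMap.lsmul ℝ ℝ, μ] f, ?_, fun x hx => ?_, fun u v h =>
    h.convolution μ φ hf⟩
  · exact φ.hasCompactSupport_normed.contDiff_convolution_left (n := 2) _ φ.contDiff_normed
      hf.locallyIntegrable
  · refine φ.dist_normed_convolution_le hf.aestronglyMeasurable fun y hy => ?_
    have := @hδf x y (by rw [dist_comm]; exact hy) hx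
    rw [dist_comm]
    exact (show dist (f x) (f y) < ε from this).le

end

/-! ### Comparison of linear images under radial weights -/

section

variable {ι : Type*} [Fintype ι] [DecidableEq ι]

theorem fderiv_fderiv_comp_add_mulVec {f : (ι → ℝ) → ℝ} (hf : ContDiff ℝ 2 f) (a : ι → ℝ)
    (M : Matrix ι ι ℝ) (w u v : ι → ℝ) :
    fderiv ℝ (fderiv ℝ fun w => f (a + M *ᵥ w)) w u v =
      fderiv ℝ (fderiv ℝ f) (a + M *ᵥ w) (M *ᵥ u) (M *ᵥ v) := by
  let L : (ι → ℝ) →L[ℝ] (ι → ℝ) := LinearMap.toContinuousLinearMap (Matrix.toLin' M)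
  have hL : ∀ w, L w = M *ᵥ w := fun w => by simp [L]
  simp_rw [← hL]
  have hA : ∀ w, HasFDerivAt (fun w => a + L w) L w := fun w => L.hasFDerivAt.const_add a
  have hf1 : ContDiff ℝ 1 (fderiv ℝ f) := hf.fderiv_right (by norm_num)
  have h1 : (fderiv ℝ fun w => f (a + L w)) = fun w => (fderiv ℝ f (a + L w)).comp L := by
    ext1 w
    exact ((hf.differentiable (by simp) _).hasFDerivAt.comp w (hA w)).fderiv
  have h2 : HasFDerivAt (fun w => fderiv ℝ f (a + L w)) _ w :=
    (hf1.differentiable (by simp) (a + L w)).hasFDerivAt.comp w (hA w)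
  rw [h1, (h2.clm_comp (hasFDerivAt_const L w)).fderiv]
  simp

theorem bilinear_apply_eq_sum_pi_single (B : (ι → ℝ) →L[ℝ] (ι → ℝ) →L[ℝ] ℝ) (u v : ι → ℝ) :
    B u v = ∑ i, ∑ j, u i * v j * B (Pi.single i 1) (Pi.single j 1) := by
  rw [← ContinuousLinearMap.flip_apply, ContinuousLinearMap.apply_eq_sum_pi_single]
  refine Finset.sum_congr rfl fun i _ => ?_
  rw [ContinuousLinearMap.flip_apply, ContinuousLinearMap.apply_eq_sum_pi_single, Finset.mul_sum]
  exact Finset.sum_congr rfl fun j _ => by ring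

/-- Both sides are the trace pairing of `M diag(c) M'` with `B`. It converts pure second derivatives
in the coordinates `w` into a pairing of `T - S` with the Hessian of `f`; rectangular `M` is allowed
so that it also handles completely positive factorizations. -/
theorem sum_mul_bilinear_mulVec_single {κ : Type*} [Fintype κ] [DecidableEq κ]
    (B : (ι → ℝ) →L[ℝ] (ι → ℝ) →L[ℝ] ℝ) (M : Matrix ι κ ℝ) (c : κ → ℝ) :
    ∑ i, c i * B (M *ᵥ Pi.single i 1) (M *ᵥ Pi.single i 1) =
      ∑ i, ∑ j, (M * diagonal c * Mᵀ) i j * B (Pi.single i 1) (Pi.single j 1) := by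
  have h : ∀ i j, (M * diagonal c * Mᵀ) i j = ∑ k, M i k * c k * M j k := fun i j => by
    simp [Matrix.mul_apply, diagonal_apply]
  simp_rw [h, Finset.sum_mul]
  rw [Finset.sum_congr rfl fun i _ => Finset.sum_comm, Finset.sum_comm]
  refine Finset.sum_congr rfl fun k _ => ?_
  rw [bilinear_apply_eq_sum_pi_single, Finset.mul_sum]
  refine Finset.sum_congr rfl fun i _ => ?_
  rw [Finset.mul_sum]
  refine Finset.sum_congr rfl fun j _ => ?_
  simp
  ring

theorem integral_kernel_mul_le_of_contDiff {k : ℝ → ℝ} (hk : Continuous k)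
    (hc : HasCompactSupport k) (h0 : 0 ≤ k) {f : (ι → ℝ) → ℝ} (hf : ContDiff ℝ 2 f)
    {S T M : Matrix ι ι ℝ} {l : ι → ℝ} (hl : ∀ i, 0 < l i) (hS : S = M * Mᵀ)
    (hT : T = M * diagonal l * Mᵀ)
    (hST : ∀ x, 0 ≤ ∑ i, ∑ j, (T - S) i j *
      fderiv ℝ (fderiv ℝ f) x (Pi.single i 1) (Pi.single j 1)) (a : ι → ℝ) :
    ∫ w : ι → ℝ, k (w ⬝ᵥ w) * f (a + M *ᵥ w) ≤
      ∫ w : ι → ℝ, k (w ⬝ᵥ w) * f (a + M *ᵥ ((fun i => √(l i)) * w)) := by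
  have hM : ContDiff ℝ 2 fun w : ι → ℝ => a + M *ᵥ w :=
    contDiff_const.add (LinearMap.toContinuousLinearMap (Matrix.toLin' M)).contDiff
  refine integral_kernel_mul_le_integral_kernel_mul_scaling (F := fun w => f (a + M *ᵥ w))
    hk hc h0 (hf.comp hM) hl fun w => ?_
  simp_rw [fderiv_fderiv_comp_add_mulVec hf]
  rw [sum_mul_bilinear_mulVec_single]
  convert hST (a + M *ᵥ w) using 6 with i _ j _
  rw [hS, hT, ← Matrix.sub_mul]
  have : diagonal (fun i => l i - 1) = diagonal l - (1 : Matrix ι ι ℝ) := by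
    rw [← diagonal_one, diagonal_sub]
  rw [this, Matrix.mul_sub, Matrix.mul_one]

/-- The set `W` encodes the class of `f`, and `hST` says that `T - S` lies in the dual of the cone
of symmetric forms that are nonnegative on `W`. The Hessians of the mollified functions belong to
that cone, and uniform approximation on the images of the support of the kernel gives the inequality
in the limit. -/
theorem integral_kernel_mul_le_of_hasNonnegSecondDiff {k : ℝ → ℝ} (hk : Continuous k)
    (hc : HasCompactSupport k) (h0 : 0 ≤ k) {f : (ι → ℝ) → ℝ} (hf : Continuous f)
    {W : Set ((ι → ℝ) × (ι → ℝ))} (hW : ∀ p ∈ W, HasNonnegSecondDiff f p.1 p.2)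
    {S T M : Matrix ι ι ℝ} {l : ι → ℝ} (hl : ∀ i, 0 < l i) (hS : S = M * Mᵀ)
    (hT : T = M * diagonal l * Mᵀ)
    (hST : ∀ B : (ι → ℝ) →L[ℝ] (ι → ℝ) →L[ℝ] ℝ, (∀ u v, B u v = B v u) →
      (∀ p ∈ W, 0 ≤ B p.1 p.2) →
      0 ≤ ∑ i, ∑ j, (T - S) i j * B (Pi.single i 1) (Pi.single j 1)) (a : ι → ℝ) :
    ∫ w : ι → ℝ, k (w ⬝ᵥ w) * f (a + M *ᵥ w) ≤
      ∫ w : ι → ℝ, k (w ⬝ᵥ w) * f (a + M *ᵥ ((fun i => √(l i)) * w)) := by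
  have hq := continuous_dotProduct_self (ι := ι)
  obtain ⟨K, -, -, R, -, hR⟩ := exists_antideriv_of_hasCompactSupport hk hc h0
  have hsk : HasCompactSupport fun w : ι → ℝ => k (w ⬝ᵥ w) :=
    hasCompactSupport_comp_dotProduct_self fun s hs => (hR s hs).2
  have hki : Integrable fun w : ι → ℝ => k (w ⬝ᵥ w) :=
    Continuous.integrable_of_hasCompactSupport (by fun_prop) hsk
  set A : (ι → ℝ) → (ι → ℝ) := fun w => a + M *ᵥ w
  set A' : (ι → ℝ) → (ι → ℝ) := fun w => a + M *ᵥ ((fun i => √(l i)) * w)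
  have hA : Continuous A := by fun_prop
  have hA' : Continuous A' := by fun_prop
  have hint : ∀ (h : (ι → ℝ) → ℝ) (_ : Continuous h) (C : (ι → ℝ) → (ι → ℝ)) (_ : Continuous C),
      Integrable fun w : ι → ℝ => k (w ⬝ᵥ w) * h (C w) := fun h hh C hC =>
    Continuous.integrable_of_hasCompactSupport (by fun_prop) hsk.mul_right
  set c := ∫ w : ι → ℝ, k (w ⬝ᵥ w)
  have hc0 : 0 ≤ c := integral_nonneg fun w => h0 _
  have key : ∀ ε > 0, ∫ w : ι → ℝ, k (w ⬝ᵥ w) * f (A w) ≤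
      (∫ w : ι → ℝ, k (w ⬝ᵥ w) * f (A' w)) + 2 * ε * c := by
    intro ε hε
    obtain ⟨h, hh, hfh, hdiff⟩ := exists_contDiff_approx hf
      ((hsk.image hA).union (hsk.image hA')) hε
    have hh1 : ContDiff ℝ 1 (fderiv ℝ h) := hh.fderiv_right (by norm_num)
    have h1 := integral_kernel_mul_le_of_contDiff hk hc h0 hh hl hS hT (fun x => hST _
      (fun u v => (hh.contDiffAt.isSymmSndFDerivAt (by simp)) u v)
      fun p hp => (hdiff _ _ (hW p hp)).fderiv_nonneg (hh.differentiable (by simp))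
        (hh1.differentiable (by simp)) x) a
    have h2 : ∫ w : ι → ℝ, k (w ⬝ᵥ w) * f (A w) ≤
        ∫ w : ι → ℝ, k (w ⬝ᵥ w) * h (A w) + ε * k (w ⬝ᵥ w) := by
      refine integral_mono (hint f hf A hA) ((hint h hh.continuous A hA).add (hki.const_mul ε))
        fun w => ?_
      by_cases hw : w ∈ tsupport fun w : ι → ℝ => k (w ⬝ᵥ w)
      · have := (abs_le.1 (hfh (A w) (Or.inl ⟨w, hw, rfl⟩))).1
        have h4 := mul_le_mul_of_nonneg_left this (show 0 ≤ k (w ⬝ᵥ w) from h0 _)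
        simp only
        linarith
      · have : k (w ⬝ᵥ w) = 0 :=
          image_eq_zero_of_notMem_tsupport (f := fun w : ι → ℝ => k (w ⬝ᵥ w)) hw
        simp [this]
    have h3 : ∫ w : ι → ℝ, k (w ⬝ᵥ w) * h (A' w) ≤
        ∫ w : ι → ℝ, k (w ⬝ᵥ w) * f (A' w) + ε * k (w ⬝ᵥ w) := by
      refine integral_mono (hint h hh.continuous A' hA') ((hint f hf A' hA').add (hki.const_mul ε))
        fun w => ?_
      by_cases hw : w ∈ tsupport fun w : ι → ℝ => k (w ⬝ᵥ w)
      · have := (abs_le.1 (hfh (A' w) (Or.inr ⟨w, hw, rfl⟩))).2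
        have h4 := mul_le_mul_of_nonneg_left this (show 0 ≤ k (w ⬝ᵥ w) from h0 _)
        simp only
        linarith
      · have : k (w ⬝ᵥ w) = 0 :=
          image_eq_zero_of_notMem_tsupport (f := fun w : ι → ℝ => k (w ⬝ᵥ w)) hw
        simp [this]
    rw [integral_add (hint h hh.continuous A hA) (hki.const_mul ε), integral_const_mul] at h2
    change _ ≤ _ + ε * c at h2
    rw [integral_add (hint f hf A' hA') (hki.const_mul ε), integral_const_mul] at h3
    change _ ≤ _ + ε * c at h3
    change ∫ w : ι → ℝ, k (w ⬝ᵥ w) * h (A w) ≤ ∫ w : ι → ℝ, k (w ⬝ᵥ w) * h (A' w) at h1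
    linarith
  -- The `+ 1` covers the case where the kernel has zero mass `c`.
  refine le_of_forall_pos_le_add fun η hη => (key (η / (2 * (c + 1))) (by positivity)).trans ?_
  have : 2 * (η / (2 * (c + 1))) * c = η * (c / (c + 1)) := by field_simp
  rw [this]
  have : c / (c + 1) ≤ 1 := (div_le_one (by positivity)).2 (by linarith)
  exact add_le_add le_rfl (mul_le_of_le_one_right hη.le this)

omit [DecidableEq ι] in
-- Push the densities `p⁺ + q⁻` and `q⁺ + p⁻` forward under `w ↦ w'w`. Their difference is `q - p`,
-- so the hypothesis orders the two measures on the line, and an arbitrary measurable weight `G` may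
-- then be integrated. Continuity of `p` and `q` makes the measures locally finite.
theorem lintegral_kernel_mul_le_of_forall_integral_le {p q : (ι → ℝ) → ℝ} (hp : Continuous p)
    (hq : Continuous q)
    (h : ∀ k : ℝ → ℝ, Continuous k → HasCompactSupport k → 0 ≤ k →
      ∫ w : ι → ℝ, k (w ⬝ᵥ w) * p w ≤ ∫ w : ι → ℝ, k (w ⬝ᵥ w) * q w)
    {G : ℝ → ℝ≥0∞} (hG : Measurable G) :
    ∫⁻ w : ι → ℝ, G (w ⬝ᵥ w) * (ENNReal.ofReal (p w) + ENNReal.ofReal (-q w)) ≤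
      ∫⁻ w : ι → ℝ, G (w ⬝ᵥ w) * (ENNReal.ofReal (q w) + ENNReal.ofReal (-p w)) := by
  have hd := continuous_dotProduct_self (ι := ι)
  let ρ : ((ι → ℝ) → ℝ) → ((ι → ℝ) → ℝ) → (ι → ℝ) → ℝ := fun p q w => max (p w) 0 + max (-q w) 0
  have hρ0 : ∀ p q w, 0 ≤ ρ p q w := fun p q w => by positivity
  have hρ : ∀ p q w, ENNReal.ofReal (ρ p q w) = ENNReal.ofReal (p w) + ENNReal.ofReal (-q w) :=
    fun p q w => by
      rw [ENNReal.ofReal_add (le_max_right _ _) (le_max_right _ _)]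
      simp [ENNReal.ofReal_max]
  let m : ((ι → ℝ) → ℝ) → ((ι → ℝ) → ℝ) → Measure ℝ := fun p q =>
    (volume.withDensity fun w => ENNReal.ofReal (ρ p q w)).map fun w => w ⬝ᵥ w
  have hρc : ∀ p q, Continuous p → Continuous q → Continuous (ρ p q) := fun p q hp hq => by
    simp only [ρ]; fun_prop
  have hm : ∀ p q, Continuous p → Continuous q → IsLocallyFiniteMeasure (m p q) := by
    intro p q hp hq
    refine ⟨fun s => ⟨Set.Iio (s + 1), Iio_mem_nhds (by linarith), ?_⟩⟩
    rw [Measure.map_apply hd.measurable measurableSet_Iio,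
      withDensity_apply _ (hd.measurable measurableSet_Iio)]
    have hs : (fun w : ι → ℝ => w ⬝ᵥ w) ⁻¹' Set.Iio (s + 1) ⊆
        Metric.closedBall 0 (√(s + 1)) := fun w hw => by
      exact mem_closedBall_zero_iff.2
        ((norm_le_sqrt_dotProduct_self w).trans (Real.sqrt_le_sqrt (le_of_lt hw)))
    refine (lintegral_mono_set hs).trans_lt ?_
    have := ((hρc p q hp hq).continuousOn.integrableOn_compact (μ := volume)
      (isCompact_closedBall (0 : ι → ℝ) (√(s + 1)))).lintegral_lt_top
    exact this
  have hmk : ∀ p q, Continuous p → Continuous q → ∀ k : ℝ → ℝ, Continuous k →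
      ∫ x, k x ∂(m p q) = ∫ w : ι → ℝ, k (w ⬝ᵥ w) * ρ p q w := by
    intro p q hp hq k hk
    simp only [m]
    rw [integral_map hd.aemeasurable hk.aestronglyMeasurable,
      integral_withDensity_eq_integral_toReal_smul
        (hρc p q hp hq).measurable.ennreal_ofReal (by simp)]
    refine integral_congr_ae (.of_forall fun w => ?_)
    simp only [smul_eq_mul]
    rw [ENNReal.toReal_ofReal (hρ0 p q w), mul_comm]
  have hmG : ∀ p q, Continuous p → Continuous q →
      ∫⁻ x, G x ∂(m p q) =
        ∫⁻ w : ι → ℝ, G (w ⬝ᵥ w) * (ENNReal.ofReal (p w) + ENNReal.ofReal (-q w)) := by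
    intro p q hp hq
    simp only [m]
    rw [lintegral_map hG hd.measurable]
    refine (lintegral_withDensity_eq_lintegral_mul _ (hρc p q hp hq).measurable.ennreal_ofReal
      (hG.comp hd.measurable)).trans (lintegral_congr fun w => ?_)
    simp only [Pi.mul_apply, Function.comp_apply]
    rw [hρ, mul_comm]
  rw [← hmG p q hp hq, ← hmG q p hq hp]
  refine lintegral_mono' ?_ le_rfl
  have := hm p q hp hq
  have := hm q p hq hp
  refine measure_le_of_forall_integral_le fun k hk hc h0 => ?_
  rw [hmk p q hp hq k hk, hmk q p hq hp k hk]
  obtain ⟨K, -, -, R, -, hR⟩ := exists_antideriv_of_hasCompactSupport hk hc h0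
  have hsk : HasCompactSupport fun w : ι → ℝ => k (w ⬝ᵥ w) :=
    hasCompactSupport_comp_dotProduct_self fun s hs => (hR s hs).2
  have hint : ∀ p : (ι → ℝ) → ℝ, Continuous p → Integrable fun w : ι → ℝ => k (w ⬝ᵥ w) * p w :=
    fun p hp => Continuous.integrable_of_hasCompactSupport (by fun_prop) hsk.mul_right
  have hpq : ∀ w, ρ q p w - ρ p q w = q w - p w := fun w => by
    simp only [ρ]
    have h1 : ∀ a : ℝ, max a 0 - max (-a) 0 = a := fun a => by
      rcases le_total 0 a with h | h <;> simp [h]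
    have h2 := h1 (p w)
    have h3 := h1 (q w)
    linarith
  rw [← sub_nonneg, ← integral_sub (hint _ (hρc q p hq hp)) (hint _ (hρc p q hp hq))]
  simp_rw [← mul_sub, hpq, mul_sub]
  rw [integral_sub (hint _ hq) (hint _ hp), sub_nonneg]
  exact h k hk hc h0

end

/-! ### The rank-one correction `Ω - δδ'` -/

section RankOne

variable {ι : Type*} [Fintype ι] [DecidableEq ι] {Ω : Matrix ι ι ℝ} {α δ : ι → ℝ} {s : ℝ}

theorem mulVec_vecMul_inv_of_posDef (hΩ : Ω.PosDef) (α : ι → ℝ) :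
    (Ω *ᵥ α) ᵥ* Ω⁻¹ = α := by
  have ht : Ωᵀ = Ω := by
    rw [← conjTranspose_eq_transpose_of_trivial]; exact hΩ.1
  have hdet : IsUnit Ω.det := isUnit_iff_ne_zero.2 hΩ.det_pos.ne'
  rw [← Matrix.vecMul_transpose, ht, Matrix.vecMul_vecMul, Matrix.mul_nonsing_inv _ hdet,
    Matrix.vecMul_one]

/-- This is the Sherman–Morrison formula: `Ω - δδ'` has inverse `Ω⁻¹ + αα'`. -/
theorem sub_vecMulVec_mul_inv_add_vecMulVec (hΩ : Ω.PosDef) (hs : s ^ 2 = 1 + α ⬝ᵥ (Ω *ᵥ α))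
    (hs0 : 0 < s) (hδ : δ = s⁻¹ • (Ω *ᵥ α)) :
    (Ω - vecMulVec δ δ) * (Ω⁻¹ + vecMulVec α α) = 1 := by
  have hdet : IsUnit Ω.det := isUnit_iff_ne_zero.2 hΩ.det_pos.ne'
  rw [hδ, smul_vecMulVec, vecMulVec_smul, Matrix.sub_mul, Matrix.mul_add, Matrix.mul_add,
    Matrix.mul_nonsing_inv _ hdet, mul_vecMulVec, smul_mul_assoc, smul_mul_assoc, smul_mul_assoc,
    smul_mul_assoc, vecMulVec_mul, vecMulVec_mul_vecMulVec, mulVec_vecMul_inv_of_posDef hΩ,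
    vecMulVec_smul, dotProduct_comm]
  have h : α ⬝ᵥ (Ω *ᵥ α) = s ^ 2 - 1 := by linarith
  rw [h, add_sub_assoc, add_eq_left]
  ext i j
  simp only [Matrix.sub_apply, Matrix.add_apply, Matrix.smul_apply, smul_eq_mul,
    Matrix.zero_apply]
  field_simp
  ring

theorem posDef_sub_vecMulVec (hΩ : Ω.PosDef) (hs : s ^ 2 = 1 + α ⬝ᵥ (Ω *ᵥ α))
    (hs0 : 0 < s) (hδ : δ = s⁻¹ • (Ω *ᵥ α)) : (Ω - vecMulVec δ δ).PosDef := by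
  have h1 : (Ω⁻¹ + vecMulVec α α).PosDef :=
    hΩ.inv.add_posSemidef (by simpa using posSemidef_vecMulVec_self_star α)
  have h2 := Matrix.inv_eq_left_inv (sub_vecMulVec_mul_inv_add_vecMulVec hΩ hs hs0 hδ)
  rw [← h2]
  exact h1.inv

/-- By the matrix determinant lemma, `det (Ω (Ω⁻¹ + αα')) = 1 + α'Ωα = s²`. -/
theorem det_sub_vecMulVec_mul_sq (hΩ : Ω.PosDef) (hs : s ^ 2 = 1 + α ⬝ᵥ (Ω *ᵥ α))
    (hs0 : 0 < s) (hδ : δ = s⁻¹ • (Ω *ᵥ α)) :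
    (Ω - vecMulVec δ δ).det * s ^ 2 = Ω.det := by
  have hdet : IsUnit Ω.det := isUnit_iff_ne_zero.2 hΩ.det_pos.ne'
  have h1 := congrArg Matrix.det (sub_vecMulVec_mul_inv_add_vecMulVec hΩ hs hs0 hδ)
  have h2 : Ω * (Ω⁻¹ + vecMulVec α α) =
      1 + replicateCol Unit (Ω *ᵥ α) * replicateRow Unit α := by
    rw [Matrix.mul_add, Matrix.mul_nonsing_inv _ hdet, mul_vecMulVec, vecMulVec_eq Unit]
  have h3 := congrArg Matrix.det h2
  rw [det_one_add_replicateCol_mul_replicateRow, ← hs, det_mul] at h3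
  rw [det_mul, det_one] at h1
  rw [← h3, mul_left_comm, h1, mul_one]

/-- The substitution `u = α'y - s z` in `q(y) + u²` exhibits the quadratic form of `(z, y - z δ)`
with scale `diag(1, Ω - δδ')`, and it turns the constraint `u ≤ α'y` into `z ≥ 0`. -/
theorem quadratic_form_completion (hΩ : Ω.PosDef) (hs : s ^ 2 = 1 + α ⬝ᵥ (Ω *ᵥ α))
    (hs0 : 0 < s) (hδ : δ = s⁻¹ • (Ω *ᵥ α)) (y : ι → ℝ) (z : ℝ) :
    y ⬝ᵥ (Ω⁻¹ *ᵥ y) + (α ⬝ᵥ y - s * z) ^ 2 =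
      z ^ 2 + (y - z • δ) ⬝ᵥ ((Ω - vecMulVec δ δ)⁻¹ *ᵥ (y - z • δ)) := by
  have hdet : IsUnit Ω.det := isUnit_iff_ne_zero.2 hΩ.det_pos.ne'
  rw [Matrix.inv_eq_right_inv (sub_vecMulVec_mul_inv_add_vecMulVec hΩ hs hs0 hδ)]
  have h1 : Ω⁻¹ *ᵥ δ = s⁻¹ • α := by
    rw [hδ, Matrix.mulVec_smul, Matrix.mulVec_mulVec, Matrix.nonsing_inv_mul _ hdet,
      Matrix.one_mulVec]
  have h2 : ∀ v, δ ⬝ᵥ (Ω⁻¹ *ᵥ v) = s⁻¹ * (α ⬝ᵥ v) := fun v => by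
    rw [dotProduct_mulVec, hδ, Matrix.smul_vecMul, mulVec_vecMul_inv_of_posDef hΩ,
      smul_dotProduct, smul_eq_mul]
  have h3 : α ⬝ᵥ δ = s⁻¹ * (s ^ 2 - 1) := by
    rw [hδ, dotProduct_smul, smul_eq_mul]
    congr 1
    linarith
  simp only [Matrix.add_mulVec, vecMulVec_mulVec, Matrix.mulVec_sub, Matrix.mulVec_smul, h1,
    sub_dotProduct, dotProduct_sub, dotProduct_add, dotProduct_smul, smul_dotProduct, h2, h3,
    smul_eq_mul, op_smul_eq_smul, dotProduct_comm y α,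
    dotProduct_comm δ α]
  field_simp
  ring

end RankOne

/-! ### Affine changes of variables -/

section ChangeOfVariables

theorem lintegral_eq_mul_lintegral_comp_sub_mul (φ : ℝ → ℝ≥0∞) (hφ : Measurable φ) (c : ℝ)
    {s : ℝ} (hs : 0 < s) :
    ∫⁻ u, φ u = ENNReal.ofReal s * ∫⁻ z, φ (c - s * z) := by
  have h1 : ∫⁻ u, φ (c - u) = ∫⁻ u, φ u := lintegral_sub_left_eq_self φ c
  rw [← h1]
  conv_lhs => rw [← Real.smul_map_volume_mul_left hs.ne']
  rw [lintegral_smul_measure, lintegral_map (by fun_prop) (by fun_prop), abs_of_pos hs, smul_eq_mul]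

variable {ι : Type*} [Fintype ι] [DecidableEq ι]

theorem lintegral_eq_mul_lintegral_comp_add_mulVec {φ : (ι → ℝ) → ℝ≥0∞} (hφ : Measurable φ)
    (a : ι → ℝ) {L : Matrix ι ι ℝ} (hL : L.det ≠ 0) :
    ∫⁻ x, φ x = ENNReal.ofReal |L.det| * ∫⁻ w, φ (a + L *ᵥ w) := by
  have h1 : ∫⁻ x, φ (a + x) = ∫⁻ x, φ x := lintegral_add_left_eq_self φ a
  have hm : Measurable fun w : ι → ℝ => L *ᵥ w := by fun_prop
  have h2 : Measure.map (fun w : ι → ℝ => L *ᵥ w) volume =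
      ENNReal.ofReal |L.det⁻¹| • volume := by
    rw [← Real.map_matrix_volume_pi_eq_smul_volume_pi hL]
    rfl
  have h3 : ∫⁻ w, φ (a + L *ᵥ w) = ENNReal.ofReal |L.det⁻¹| * ∫⁻ x, φ x := by
    rw [← h1, ← smul_eq_mul, ← lintegral_smul_measure, ← h2, lintegral_map (by fun_prop) hm]
  rw [h3, ← mul_assoc, ← ENNReal.ofReal_mul (abs_nonneg _), ← abs_mul, mul_inv_cancel₀ hL]
  simp

theorem dotProduct_mulVec_inv_mul_transpose {S L : Matrix ι ι ℝ} (hL : L.det ≠ 0)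
    (hS : S = L * Lᵀ) (w : ι → ℝ) : (L *ᵥ w) ⬝ᵥ (S⁻¹ *ᵥ (L *ᵥ w)) = w ⬝ᵥ w := by
  have hu : IsUnit L.det := isUnit_iff_ne_zero.2 hL
  have hu' : IsUnit Lᵀ.det := by rwa [det_transpose]
  have h : Lᵀ * (S⁻¹ * L) = 1 := by
    rw [hS, Matrix.mul_inv_rev, Matrix.mul_assoc, Matrix.nonsing_inv_mul _ hu, Matrix.mul_one,
      Matrix.mul_nonsing_inv _ hu']
  have h' : L *ᵥ w = w ᵥ* Lᵀ := (Matrix.vecMul_transpose _ _).symm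
  conv_lhs => rw [Matrix.mulVec_mulVec, h', ← dotProduct_mulVec, Matrix.mulVec_mulVec, h,
    Matrix.one_mulVec]

end ChangeOfVariables

/-! ### The stochastic representation of skew-elliptical laws -/

namespace HessianOrder

variable {n : ℕ} {g : ℝ → ℝ}

theorem IsDensityGenerator.lintegral_marginalGenerator (hg : IsDensityGenerator (n + 1) g) :
    ∫⁻ y : Fin n → ℝ, marginalGenerator g (y ⬝ᵥ y) = 1 := by
  have h := hg.lintegral_eq_one
  have hgm := hg.measurable
  have hd := (continuous_dotProduct_self (ι := Fin n)).measurable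
  let F : ℝ × (Fin n → ℝ) → ℝ≥0∞ := fun p => ENNReal.ofReal (g (p.2 ⬝ᵥ p.2 + p.1 ^ 2))
  have hF : Measurable F := by
    have : Measurable fun p : ℝ × (Fin n → ℝ) => p.2 ⬝ᵥ p.2 := hd.comp measurable_snd
    fun_prop
  have e := (volume_preserving_piFinSuccAbove (fun _ : Fin (n + 1) => ℝ) 0).lintegral_comp hF
  have e2 : ∀ z : Fin (n + 1) → ℝ,
      F (MeasurableEquiv.piFinSuccAbove (fun _ : Fin (n + 1) => ℝ) 0 z) =
        ENNReal.ofReal (g (z ⬝ᵥ z)) := fun z => by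
    simp only [F, MeasurableEquiv.piFinSuccAbove_apply, dotProduct, Fin.sum_univ_succ]
    congr 2
    simp [Fin.insertNthEquiv, Fin.tail, add_comm, sq]
  simp_rw [e2, h] at e
  rw [e]
  exact lintegral_prod_symm _ hF.aemeasurable |>.symm

theorem marginalGenerator_mul_conditionalCdf {q : ℝ} (hg : Measurable g)
    (hq : marginalGenerator g q ≠ ∞) (c : ℝ) :
    marginalGenerator g q * conditionalCdf g q c =
      ∫⁻ u in Set.Iic c, ENNReal.ofReal (g (q + u ^ 2)) := by
  have hm : Measurable fun u : ℝ => ENNReal.ofReal (g (q + u ^ 2)) := by fun_prop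
  simp only [conditionalCdf, div_eq_mul_inv]
  rw [lintegral_mul_const _ hm]
  rcases eq_or_ne (marginalGenerator g q) 0 with h | h
  -- Where the marginal generator vanishes no cancellation is possible, but the truncated integral
  -- vanishes as well.
  · have : ∫⁻ u in Set.Iic c, ENNReal.ofReal (g (q + u ^ 2)) = 0 :=
      le_antisymm ((setLIntegral_le_lintegral _ _).trans_eq h) zero_le
    rw [this, h, zero_mul]
  · rw [mul_comm, mul_assoc, ENNReal.inv_mul_cancel h hq, mul_one]

/-- The normalization inside `conditionalCdf` cancels only where the marginal generator is finite.
This holds almost everywhere because, after whitening by a square root of `Ω`, its integral is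
finite. -/
theorem IsDensityGenerator.ae_marginalGenerator_ne_top (hg : IsDensityGenerator (n + 1) g)
    {Ω : Matrix (Fin n) (Fin n) ℝ} (hΩ : Ω.PosDef) (μ : Fin n → ℝ) :
    ∀ᵐ x : Fin n → ℝ, marginalGenerator g ((x - μ) ⬝ᵥ (Ω⁻¹ *ᵥ (x - μ))) ≠ ∞ := by
  have hgm := hg.measurable
  obtain ⟨A, hA⟩ := exists_mul_transpose_of_posSemidef hΩ.posSemidef
  have hdet : A.det ≠ 0 := fun h0 => by
    have := hΩ.det_pos
    rw [hA, det_mul, h0] at this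
    simp at this
  have hmg : Measurable (marginalGenerator g) :=
    Measurable.lintegral_prod_right' (f := fun p : ℝ × ℝ => ENNReal.ofReal (g (p.1 + p.2 ^ 2)))
      (by fun_prop)
  have hm : Measurable fun x : Fin n → ℝ =>
      marginalGenerator g ((x - μ) ⬝ᵥ (Ω⁻¹ *ᵥ (x - μ))) :=
    hmg.comp (by unfold dotProduct; fun_prop)
  refine (ae_lt_top hm ?_).mono fun x hx => hx.ne
  rw [lintegral_eq_mul_lintegral_comp_add_mulVec hm μ hdet]
  simp_rw [add_sub_cancel_left, dotProduct_mulVec_inv_mul_transpose hdet hA,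
    hg.lintegral_marginalGenerator]
  simp

/-- Undo the cdf as an integral over `u ≤ α'(x - μ)`, substitute `u = α'(x - μ) - s z`, complete the
square, and whiten `x - μ - z δ` by `L`. Any square root `L` is admitted, which later permits
simultaneous ones for `X` and `Y`. -/
theorem IsSkewElliptical.lintegral_comp {S : Type*} [MeasurableSpace S] {P : Measure S}
    {X : S → Fin n → ℝ} {μ α : Fin n → ℝ} {Ω L : Matrix (Fin n) (Fin n) ℝ}
    (hX : IsSkewElliptical P X μ Ω α g)
    (hL : Ω - vecMulVec (skewnessVector Ω α) (skewnessVector Ω α) = L * Lᵀ)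
    {h : (Fin n → ℝ) → ℝ≥0∞} (hh : Measurable h) :
    ∫⁻ s, h (X s) ∂P = 2 * ∫⁻ z in Set.Ici (0 : ℝ), ∫⁻ w : Fin n → ℝ,
      ENNReal.ofReal (g (z ^ 2 + w ⬝ᵥ w)) * h (μ + z • skewnessVector Ω α + L *ᵥ w) := by
  have hg := hX.generator.measurable
  have hΩ := hX.posDef
  set s : ℝ := √(1 + α ⬝ᵥ (Ω *ᵥ α))
  have ha : 0 ≤ α ⬝ᵥ (Ω *ᵥ α) := by simpa using hΩ.posSemidef.dotProduct_mulVec_nonneg α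
  have hs : s ^ 2 = 1 + α ⬝ᵥ (Ω *ᵥ α) := Real.sq_sqrt (by linarith)
  have hs0 : 0 < s := Real.sqrt_pos.2 (by linarith)
  set δ := skewnessVector Ω α
  have hδ : δ = s⁻¹ • (Ω *ᵥ α) := rfl
  have hdetS := det_sub_vecMulVec_mul_sq hΩ hs hs0 hδ
  have hdetpos := (posDef_sub_vecMulVec hΩ hs hs0 hδ).det_pos
  have hLdet2 : L.det ^ 2 * s ^ 2 = Ω.det := by
    rw [← hdetS, hL, det_mul, det_transpose, sq]
  have hLdet : L.det ≠ 0 := fun h0 => by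
    rw [hL, det_mul, h0] at hdetpos
    simp at hdetpos
  let q : (Fin n → ℝ) → ℝ := fun x => (x - μ) ⬝ᵥ (Ω⁻¹ *ᵥ (x - μ))
  let c : (Fin n → ℝ) → ℝ := fun x => α ⬝ᵥ (x - μ)
  have hqc : Continuous q := by simp only [q]; unfold dotProduct; fun_prop
  have hcc : Continuous c := by simp only [c]; unfold dotProduct; fun_prop
  let D : (Fin n → ℝ) × ℝ → ℝ≥0∞ := {p | p.2 ≤ c p.1}.indicator fun p =>
    ENNReal.ofReal (g (q p.1 + p.2 ^ 2))
  have hD : Measurable D := by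
    refine Measurable.indicator ?_ (measurableSet_le (by fun_prop) (by fun_prop))
    have := hqc.measurable
    fun_prop
  let C : ℝ≥0∞ := ENNReal.ofReal (2 * (√Ω.det)⁻¹)
  have hdens : skewEllipticalDensity μ Ω α g =ᵐ[volume] fun x => C * ∫⁻ u, D (x, u) := by
    filter_upwards [hX.generator.ae_marginalGenerator_ne_top hΩ μ] with x hx
    rw [skewEllipticalDensity, mul_assoc, marginalGenerator_mul_conditionalCdf hg hx,
      ← lintegral_indicator measurableSet_Iic]
    rfl
  have hDm : Measurable fun x => ∫⁻ u, D (x, u) := hD.lintegral_prod_right'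
  have hDs : ∀ x z, D (x, c x - s * z) * h x = (Set.Ici (0 : ℝ)).indicator (fun z =>
      ENNReal.ofReal (g (z ^ 2 + (x - μ - z • δ) ⬝ᵥ
        ((Ω - vecMulVec δ δ)⁻¹ *ᵥ (x - μ - z • δ)))) * h x) z := fun x z => by
    by_cases hz : 0 ≤ z
    · have h1 : (x, c x - s * z) ∈ {p : (Fin n → ℝ) × ℝ | p.2 ≤ c p.1} := by
        have := mul_nonneg hs0.le hz
        simp only [Set.mem_ofPred_eq]
        linarith
      have h2 := quadratic_form_completion hΩ hs hs0 hδ (x - μ) z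
      simp only [D]
      rw [Set.indicator_of_mem h1, Set.indicator_of_mem (Set.mem_Ici.2 hz), ← h2]
    · have h1 : (x, c x - s * z) ∉ {p : (Fin n → ℝ) × ℝ | p.2 ≤ c p.1} := by
        have := mul_neg_of_pos_of_neg hs0 (not_le.1 hz)
        simp only [Set.mem_ofPred_eq]
        linarith
      simp only [D]
      rw [Set.indicator_of_notMem h1, Set.indicator_of_notMem (by simpa using hz), zero_mul]
  have hcs : Measurable fun p : (Fin n → ℝ) × ℝ => D (p.1, c p.1 - s * p.2) * h p.1 := by
    have := hcc.measurable
    exact (hD.comp (by fun_prop)).mul (hh.comp measurable_fst)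
  -- The Jacobians `s` and `|det L|` cancel the normalization because `√(det Ω) = |det L| s`; only
  -- the factor `2` of the half-line survives.
  have hC : C * (ENNReal.ofReal s * ENNReal.ofReal |L.det|) = 2 := by
    have h1 : √Ω.det = |L.det| * s := by
      rw [← hLdet2, ← mul_pow, Real.sqrt_sq_eq_abs, abs_mul, abs_of_pos hs0]
    have h2 := abs_pos.2 hLdet
    simp only [C]
    rw [h1, ← ENNReal.ofReal_mul hs0.le, ← ENNReal.ofReal_mul (by positivity)]
    have : 2 * (|L.det| * s)⁻¹ * (s * |L.det|) = 2 := by field_simp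
    rw [this]
    simp
  calc ∫⁻ s, h (X s) ∂P = ∫⁻ x, h x ∂(P.map X) := (lintegral_map' hh.aemeasurable hX.aemeasurable).symm
    _ = ∫⁻ x, (C * ∫⁻ u, D (x, u)) * h x := by
        rw [hX.map_eq, withDensity_congr_ae hdens]
        exact lintegral_withDensity_eq_lintegral_mul _ (hDm.const_mul C) hh
    _ = C * ∫⁻ x, ∫⁻ u, D (x, u) * h x := by
        simp_rw [mul_assoc]
        rw [lintegral_const_mul _ (f := fun x => (∫⁻ u, D (x, u)) * h x) (hDm.mul hh)]
        congr 1
        refine lintegral_congr fun x => ?_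
        exact (lintegral_mul_const _ (hD.comp measurable_prodMk_left)).symm
    _ = C * ∫⁻ x, ENNReal.ofReal s * ∫⁻ z, D (x, c x - s * z) * h x := by
        congr 1
        refine lintegral_congr fun x => ?_
        exact lintegral_eq_mul_lintegral_comp_sub_mul (fun u => D (x, u) * h x)
          ((hD.comp measurable_prodMk_left).mul_const _) (c x) hs0
    _ = C * (ENNReal.ofReal s * ∫⁻ z, ∫⁻ x, D (x, c x - s * z) * h x) := by
        rw [lintegral_const_mul _ hcs.lintegral_prod_right', lintegral_lintegral_swap hcs.aemeasurable]
    _ = C * (ENNReal.ofReal s * ∫⁻ z in Set.Ici (0 : ℝ), ENNReal.ofReal |L.det| *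
        ∫⁻ w : Fin n → ℝ, ENNReal.ofReal (g (z ^ 2 + w ⬝ᵥ w)) * h (μ + z • δ + L *ᵥ w)) := by
        rw [← lintegral_indicator measurableSet_Ici]
        congr 2
        refine lintegral_congr fun z => ?_
        simp_rw [hDs]
        by_cases hz : z ∈ Set.Ici (0 : ℝ)
        · simp_rw [Set.indicator_of_mem hz]
          rw [lintegral_eq_mul_lintegral_comp_add_mulVec _ (μ + z • δ) hLdet]
          · congr 1
            refine lintegral_congr fun w => ?_
            have : μ + z • δ + L *ᵥ w - μ - z • δ = L *ᵥ w := by abel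
            rw [this, dotProduct_mulVec_inv_mul_transpose hLdet hL]
          · have : Measurable fun x : Fin n → ℝ => (x - μ - z • δ) ⬝ᵥ
                ((Ω - vecMulVec δ δ)⁻¹ *ᵥ (x - μ - z • δ)) := by
              unfold dotProduct; fun_prop
            fun_prop
        · simp [Set.indicator_of_notMem hz]
    _ = _ := by
        rw [lintegral_const_mul]
        · rw [← mul_assoc, ← mul_assoc, mul_assoc C, hC]
        · refine Measurable.lintegral_prod_right' (f := fun p : ℝ × (Fin n → ℝ) =>
            ENNReal.ofReal (g (p.1 ^ 2 + p.2 ⬝ᵥ p.2)) * h (μ + p.1 • δ + L *ᵥ p.2)) ?_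
          have h1 : Measurable fun p : ℝ × (Fin n → ℝ) => p.2 ⬝ᵥ p.2 :=
            (continuous_dotProduct_self (ι := Fin n)).measurable.comp measurable_snd
          have h2 : Measurable fun p : ℝ × (Fin n → ℝ) => μ + p.1 • δ + L *ᵥ p.2 :=
            Continuous.measurable (by fun_prop)
          exact (hg.comp ((measurable_fst.pow_const 2).add h1)).ennreal_ofReal.mul (hh.comp h2)

end HessianOrder

/-- If `b = ∞` the left side is `⊥`, and if `c = ∞` the right side is `⊤`; otherwise everything is
finite. -/
theorem EReal.coe_ennreal_sub_le_coe_ennreal_sub {a b c d : ℝ≥0∞} (h : a + d ≤ c + b)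
    (hab : a ≠ ∞ ∨ b ≠ ∞) (hcd : c ≠ ∞ ∨ d ≠ ∞) : (a : EReal) - b ≤ (c : EReal) - d := by
  rcases eq_or_ne b ∞ with rfl | hb
  · have ha : a ≠ ∞ := by simpa using hab
    lift a to NNReal using ha
    simp [sub_eq_add_neg]
  rcases eq_or_ne c ∞ with rfl | hc
  · have hd : d ≠ ∞ := by simpa using hcd
    lift d to NNReal using hd
    have : ((⊤ : ℝ≥0∞) : EReal) - ((d : ℝ≥0∞) : EReal) = ⊤ := by
      simp [EReal.coe_ennreal_top]
    rw [this]
    exact le_top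
  have hcb : c + b ≠ ∞ := by simp [hb, hc]
  have had := ne_top_of_le_ne_top hcb h
  have ha : a ≠ ∞ := fun h0 => had (by simp [h0])
  have hd : d ≠ ∞ := fun h0 => had (by simp [h0])
  lift a to NNReal using ha
  lift b to NNReal using hb
  lift c to NNReal using hc
  lift d to NNReal using hd
  have h' : (a : ℝ) + d ≤ c + b := by exact_mod_cast h
  have : (a : ℝ) - b ≤ (c : ℝ) - d := by linarith
  simp only [EReal.coe_nnreal_eq_coe_real]
  rw [← EReal.coe_sub, ← EReal.coe_sub]
  exact EReal.coe_le_coe_iff.2 this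

/-! ### From radial comparison to stochastic orders -/

namespace HessianOrder

variable {n : ℕ}

/-- The radial comparison of the linear images of spherical laws with scale matrices `S` and `T`:
for every pair of simultaneous square roots of `S` and `T` and every radial kernel. -/
def RadialLE (S T : Matrix (Fin n) (Fin n) ℝ) (f : (Fin n → ℝ) → ℝ) : Prop :=
  ∀ (M : Matrix (Fin n) (Fin n) ℝ) (l : Fin n → ℝ), (∀ i, 0 < l i) → S = M * Mᵀ →
    T = M * diagonal l * Mᵀ → ∀ k : ℝ → ℝ, Continuous k → HasCompactSupport k → 0 ≤ k →
    ∀ a : Fin n → ℝ, ∫ w : Fin n → ℝ, k (w ⬝ᵥ w) * f (a + M *ᵥ w) ≤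
      ∫ w : Fin n → ℝ, k (w ⬝ᵥ w) * f (a + M *ᵥ ((fun i => √(l i)) * w))

theorem posDef_sub_vecMulVec_skewnessVector {Ω : Matrix (Fin n) (Fin n) ℝ} (hΩ : Ω.PosDef) (α : Fin n → ℝ) :
    (Ω - vecMulVec (skewnessVector Ω α) (skewnessVector Ω α)).PosDef := by
  have ha : 0 ≤ α ⬝ᵥ (Ω *ᵥ α) := by simpa using hΩ.posSemidef.dotProduct_mulVec_nonneg α
  exact posDef_sub_vecMulVec hΩ (Real.sq_sqrt (by linarith)) (Real.sqrt_pos.2 (by linarith)) rfl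

section

variable {S T : Type*} [MeasurableSpace S] [MeasurableSpace T] {P : Measure S} {Q : Measure T}
  {X : S → Fin n → ℝ} {Y : T → Fin n → ℝ} {μ αx αy δ : Fin n → ℝ}
  {Ωx Ωy : Matrix (Fin n) (Fin n) ℝ} {g : ℝ → ℝ}

/-- The square roots `M` and `M diag(√l)` represent both laws over the same variables `(z, w)` with
the same weight. The inner integrals over `w` are then compared for each fixed `z`, with centre `μ +
z δ`. -/
theorem expectation_le_of_radialLE (hX : IsSkewElliptical P X μ Ωx αx g)
    (hY : IsSkewElliptical Q Y μ Ωy αy g) (hδx : skewnessVector Ωx αx = δ)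
    (hδy : skewnessVector Ωy αy = δ) {f : (Fin n → ℝ) → ℝ} (hf : Continuous f)
    (h : RadialLE (Ωx - vecMulVec δ δ) (Ωy - vecMulVec δ δ) f)
    (hfX : HasExpectation P fun s => f (X s)) (hfY : HasExpectation Q fun t => f (Y t)) :
    expectation P (fun s => f (X s)) ≤ expectation Q fun t => f (Y t) := by
  obtain ⟨M, l, hl, hM, hMl⟩ := exists_simultaneous_diagonalization
    (by simpa only [hδx] using posDef_sub_vecMulVec_skewnessVector hX.posDef αx)
    (by simpa only [hδy] using posDef_sub_vecMulVec_skewnessVector hY.posDef αy)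
  have hML : Ωy - vecMulVec δ δ = (M * diagonal fun i => √(l i)) *
      (M * diagonal fun i => √(l i))ᵀ := by
    rw [hMl, transpose_mul, diagonal_transpose, Matrix.mul_assoc M (diagonal fun i => √(l i)),
      ← Matrix.mul_assoc (diagonal _), diagonal_mul_diagonal, ← Matrix.mul_assoc]
    simp_rw [Real.mul_self_sqrt (hl _).le]
  have hMw : ∀ w, (M * diagonal fun i => √(l i)) *ᵥ w = M *ᵥ ((fun i => √(l i)) * w) := fun w => by
    rw [← Matrix.mulVec_mulVec]
    congr 1
    ext i
    simp [mulVec_diagonal]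
  have hg := hX.generator.measurable
  have hd := (continuous_dotProduct_self (ι := Fin n)).measurable
  have hIX := fun {φ : (Fin n → ℝ) → ℝ≥0∞} (hφ : Measurable φ) =>
    hX.lintegral_comp (L := M) (by rw [hδx]; exact hM) hφ
  have hIY := fun {φ : (Fin n → ℝ) → ℝ≥0∞} (hφ : Measurable φ) =>
    hY.lintegral_comp (L := M * diagonal fun i => √(l i)) (by rw [hδy]; exact hML) hφ
  simp_rw [hδx] at hIX
  simp_rw [hδy, hMw] at hIY
  have hpos : Measurable fun x => ENNReal.ofReal (f x) := hf.measurable.ennreal_ofReal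
  have hneg : Measurable fun x => ENNReal.ofReal (-f x) := hf.measurable.neg.ennreal_ofReal
  let A : ℝ → (Fin n → ℝ) → (Fin n → ℝ) := fun z w => μ + z • δ + M *ᵥ w
  let A' : ℝ → (Fin n → ℝ) → (Fin n → ℝ) := fun z w =>
    μ + z • δ + M *ᵥ ((fun i => √(l i)) * w)
  have hA : Measurable (Function.uncurry A) :=
    Continuous.measurable (by simp only [A, Function.uncurry_def]; fun_prop)
  have hA' : Measurable (Function.uncurry A') :=
    Continuous.measurable (by simp only [A', Function.uncurry_def]; fun_prop)
  have hG : Measurable fun p : ℝ × (Fin n → ℝ) => ENNReal.ofReal (g (p.1 ^ 2 + p.2 ⬝ᵥ p.2)) :=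
    (hg.comp ((measurable_fst.pow_const 2).add (hd.comp measurable_snd))).ennreal_ofReal
  have hadd : ∀ {φ ψ : (Fin n → ℝ) → ℝ≥0∞} {C D : ℝ → (Fin n → ℝ) → (Fin n → ℝ)},
      Measurable φ → Measurable ψ → Measurable (Function.uncurry C) →
      Measurable (Function.uncurry D) →
      2 * (∫⁻ z in Set.Ici (0 : ℝ), ∫⁻ w : Fin n → ℝ,
        ENNReal.ofReal (g (z ^ 2 + w ⬝ᵥ w)) * φ (C z w)) +
      2 * (∫⁻ z in Set.Ici (0 : ℝ), ∫⁻ w : Fin n → ℝ,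
        ENNReal.ofReal (g (z ^ 2 + w ⬝ᵥ w)) * ψ (D z w)) =
      2 * ∫⁻ z in Set.Ici (0 : ℝ), ∫⁻ w : Fin n → ℝ,
        ENNReal.ofReal (g (z ^ 2 + w ⬝ᵥ w)) * (φ (C z w) + ψ (D z w)) := by
    intro φ ψ C D hφ hψ hC hD
    have h1 : Measurable fun p : ℝ × (Fin n → ℝ) =>
        ENNReal.ofReal (g (p.1 ^ 2 + p.2 ⬝ᵥ p.2)) * φ (C p.1 p.2) := hG.mul (hφ.comp hC)
    rw [← mul_add, ← lintegral_add_left h1.lintegral_prod_right']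
    congr 1
    refine lintegral_congr fun z => ?_
    simp_rw [mul_add]
    exact (lintegral_add_left (h1.comp measurable_prodMk_left) _).symm
  refine EReal.coe_ennreal_sub_le_coe_ennreal_sub ?_ hfX hfY
  rw [hIX hpos, hIX hneg, hIY hpos, hIY hneg, hadd hpos hneg hA hA', hadd hpos hneg hA' hA]
  refine mul_le_mul_right (lintegral_mono fun z => ?_) _
  exact lintegral_kernel_mul_le_of_forall_integral_le (p := fun w => f (A z w))
    (q := fun w => f (A' z w)) (by fun_prop) (by fun_prop)
    (fun k hk hc h0 => h M l hl hM hMl k hk hc h0 (μ + z • δ))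
    (G := fun t => ENNReal.ofReal (g (z ^ 2 + t))) (by fun_prop)

/-- The common term `δδ'` cancels, so only the difference `Ωy - Ωx` matters. -/
theorem integralOrder_of_radialLE (hX : IsSkewElliptical P X μ Ωx αx g)
    (hY : IsSkewElliptical Q Y μ Ωy αy g) (hδ : skewnessVector Ωx αx = skewnessVector Ωy αy)
    {F : Set ((Fin n → ℝ) → ℝ)} (hF : ∀ f ∈ F, Continuous f)
    (h : ∀ f ∈ F, ∀ S T : Matrix (Fin n) (Fin n) ℝ, T - S = Ωy - Ωx → RadialLE S T f) :
    IntegralOrder F P X Q Y := fun f hf hfX hfY =>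
  expectation_le_of_radialLE hX hY hδ rfl (hF f hf)
    (h f hf _ _ (sub_sub_sub_cancel_right _ _ _)) hfX hfY

end

/-! ### The dual pairs of cones -/

section

variable {f : (Fin n → ℝ) → ℝ} {S T : Matrix (Fin n) (Fin n) ℝ}

theorem radialLE_of_contDiff (hf : ContDiff ℝ 2 f)
    (h : ∀ x, 0 ≤ ∑ i, ∑ j, (T - S) i j * hessian f x i j) : RadialLE S T f :=
  fun _ _ hl hS hT _ hk hc h0 a => integral_kernel_mul_le_of_contDiff hk hc h0 hf hl hS hT h a

theorem radialLE_of_hasNonnegSecondDiff (hf : Continuous f)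
    {W : Set ((Fin n → ℝ) × (Fin n → ℝ))} (hW : ∀ p ∈ W, HasNonnegSecondDiff f p.1 p.2)
    (h : ∀ B : (Fin n → ℝ) →L[ℝ] (Fin n → ℝ) →L[ℝ] ℝ, (∀ u v, B u v = B v u) →
      (∀ p ∈ W, 0 ≤ B p.1 p.2) →
      0 ≤ ∑ i, ∑ j, (T - S) i j * B (Pi.single i 1) (Pi.single j 1)) : RadialLE S T f :=
  fun _ _ hl hS hT _ hk hc h0 a =>
    integral_kernel_mul_le_of_hasNonnegSecondDiff hk hc h0 hf hW hl hS hT h a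

/-- Take `W` to be the diagonal. With `T - S = AA'`, the pairing is a sum of values of `B` on the
diagonal pairs `(A eᵢ, A eᵢ)`. -/
theorem radialLE_of_convexOn (hf : ConvexOn ℝ Set.univ f) (hST : (T - S).PosSemidef) :
    RadialLE S T f := by
  refine radialLE_of_hasNonnegSecondDiff hf.locallyLipschitz.continuous (W := {p | p.1 = p.2})
    (fun p hp => by
      rw [← (show p.1 = p.2 from hp)]
      exact hf.hasNonnegSecondDiff p.1) fun B _ hB => ?_
  obtain ⟨A, hA⟩ := exists_mul_transpose_of_posSemidef hST
  have h := sum_mul_bilinear_mulVec_single B A fun _ => 1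
  rw [diagonal_one, Matrix.mul_one, ← hA] at h
  rw [← h]
  exact Finset.sum_nonneg fun i _ => mul_nonneg zero_le_one (hB (_, _) rfl)

/-- `R` lists the Hessian entries of known sign, so this serves the supermodular, directionally
convex and componentwise convex orders alike. Outside `R` and its transpose the entries of `T - S`
vanish; symmetry of `B` handles the transpose. -/
theorem radialLE_of_hessian_entries_nonneg (hf : TwiceDifferentiable f) {R : Set (Fin n × Fin n)}
    (hR : ∀ x, ∀ p ∈ R, 0 ≤ hessian f x p.1 p.2) (hST : ∀ i j, S i j ≤ T i j)
    (hST' : ∀ i j, (i, j) ∉ R → (j, i) ∉ R → S i j = T i j) : RadialLE S T f := by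
  refine radialLE_of_hasNonnegSecondDiff hf.1.continuous
    (W := (fun p : Fin n × Fin n => ((Pi.single p.1 1 : Fin n → ℝ), (Pi.single p.2 1 : Fin n → ℝ)))
      '' R) ?_ fun B hs hB => ?_
  · rintro _ ⟨p, hp, rfl⟩
    exact hasNonnegSecondDiff_of_fderiv hf.1 hf.2 fun x => hR x p hp
  · refine Finset.sum_nonneg fun i _ => Finset.sum_nonneg fun j _ => ?_
    by_cases h1 : (i, j) ∈ R
    · exact mul_nonneg (sub_nonneg.2 (hST i j)) (hB _ ⟨_, h1, rfl⟩)
    by_cases h2 : (j, i) ∈ R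
    · rw [hs]
      exact mul_nonneg (sub_nonneg.2 (hST i j)) (hB _ ⟨_, h2, rfl⟩)
    · simp [hST' i j h1 h2]

/-- With Hessian `B'B`, the pairing is the sum of the quadratic form of `T - S` over the nonnegative
rows of `B`. -/
theorem radialLE_of_isCompletelyPositive_hessian (hf : ContDiff ℝ 2 f)
    (hH : ∀ x, IsCompletelyPositive (hessian f x)) (hST : IsCopositive (T - S)) :
    RadialLE S T f := by
  refine radialLE_of_contDiff hf fun x => ?_
  obtain ⟨m, B, hB, hHB⟩ := hH x
  have h : ∑ i, ∑ j, (T - S) i j * hessian f x i j =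
      ∑ k, B k ⬝ᵥ ((T - S) *ᵥ B k) := by
    simp only [hHB, Matrix.mul_apply, transpose_apply, dotProduct, mulVec, Finset.mul_sum]
    rw [Finset.sum_congr rfl fun i _ => Finset.sum_comm, Finset.sum_comm]
    refine Finset.sum_congr rfl fun k _ => Finset.sum_congr rfl fun i _ =>
      Finset.sum_congr rfl fun j _ => ?_
    ring
  rw [h]
  exact Finset.sum_nonneg fun k _ => hST _ (hB k)

/-- The roles are exchanged: factor `T - S = B'B` and evaluate the Hessian on the nonnegative rows
of `B`. -/
theorem radialLE_of_isCopositive_hessian (hf : ContDiff ℝ 2 f)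
    (hH : ∀ x, IsCopositive (hessian f x)) (hST : IsCompletelyPositive (T - S)) :
    RadialLE S T f := by
  refine radialLE_of_contDiff hf fun x => ?_
  obtain ⟨m, B, hB, hTB⟩ := hST
  have h := sum_mul_bilinear_mulVec_single (fderiv ℝ (fderiv ℝ f) x) Bᵀ fun _ => 1
  rw [diagonal_one, Matrix.mul_one, transpose_transpose, ← hTB] at h
  change 0 ≤ ∑ i, ∑ j, (T - S) i j * fderiv ℝ (fderiv ℝ f) x (Pi.single i 1) (Pi.single j 1)
  rw [← h]
  refine Finset.sum_nonneg fun k _ => mul_nonneg zero_le_one ?_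
  have h2 := hH x (B k) (hB k)
  have h3 : Bᵀ *ᵥ Pi.single k 1 = B k := by
    ext i
    simp
  rw [h3, bilinear_apply_eq_sum_pi_single]
  convert! h2 using 1
  simp only [dotProduct, mulVec, Finset.mul_sum, hessian, Matrix.of_apply]
  refine Finset.sum_congr rfl fun i _ => Finset.sum_congr rfl fun j _ => ?_
  ring

end

end HessianOrder

open HessianOrder in
theorem theorem3p2 {n : ℕ}
    {S : Type*} [MeasurableSpace S] (P : Measure S) [IsProbabilityMeasure P]
    {T : Type*} [MeasurableSpace T] (Q : Measure T) [IsProbabilityMeasure Q]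
    (X : S → Fin n → ℝ) (Y : T → Fin n → ℝ)
    (μx μy αx αy : Fin n → ℝ) (Ωx Ωy : Matrix (Fin n) (Fin n) ℝ) (g : ℝ → ℝ)
    (hX : IsSkewElliptical P X μx Ωx αx g) (hY : IsSkewElliptical Q Y μy Ωy αy g)
    (hμ : μx = μy) (hδ : skewnessVector Ωx αx = skewnessVector Ωy αy) :
    ((Ωy - Ωx).PosSemidef → IntegralOrder (convexFunctions n) P X Q Y) ∧
    ((∀ i, Ωx i i = Ωy i i) → (∀ i j, i ≠ j → Ωx i j ≤ Ωy i j) →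
      IntegralOrder (supermodularFunctions n) P X Q Y) ∧
    ((∀ i j, Ωx i j ≤ Ωy i j) →
      IntegralOrder (directionallyConvexFunctions n) P X Q Y) ∧
    ((∀ i, Ωx i i ≤ Ωy i i) → (∀ i j, i < j → Ωx i j = Ωy i j) →
      IntegralOrder (componentwiseConvexFunctions n) P X Q Y) ∧
    (IsCopositive (Ωy - Ωx) →
      IntegralOrder (completelyPositiveFunctions n) P X Q Y) ∧
    (IsCompletelyPositive (Ωy - Ωx) →
      IntegralOrder (copositiveFunctions n) P X Q Y) := by
  subst hμ
  have hentry : ∀ {A B : Matrix (Fin n) (Fin n) ℝ}, B - A = Ωy - Ωx → ∀ i j,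
      B i j - A i j = Ωy i j - Ωx i j := fun h i j => congrFun (congrFun h i) j
  have hsymm : ∀ {Ω : Matrix (Fin n) (Fin n) ℝ}, Ω.PosDef → ∀ i j, Ω i j = Ω j i :=
    fun h i j => by simpa using (h.1.apply i j).symm
  refine ⟨fun h => ?_, fun h h' => ?_, fun h => ?_, fun h h' => ?_, fun h => ?_, fun h => ?_⟩
  · exact integralOrder_of_radialLE hX hY hδ (fun f hf => hf.locallyLipschitz.continuous)
      fun f hf A B hAB => radialLE_of_convexOn hf (hAB ▸ h)
  · refine integralOrder_of_radialLE hX hY hδ (fun f hf => hf.1.1.continuous) fun f hf A B hAB =>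
      radialLE_of_hessian_entries_nonneg hf.1 (R := {p | p.1 < p.2})
        (fun x p hp => hf.2 x p.1 p.2 hp) (fun i j => ?_) fun i j h1 h2 => ?_
    · rw [← sub_nonneg, hentry hAB, sub_nonneg]
      rcases eq_or_ne i j with rfl | hij
      · exact (h i).le
      · exact h' i j hij
    -- A pair outside `R` and its transpose lies on the diagonal, where the scale matrices agree.
    · obtain rfl : i = j := le_antisymm (not_lt.1 h2) (not_lt.1 h1)
      have := hentry hAB i i
      rw [h i] at this
      linarith
  · refine integralOrder_of_radialLE hX hY hδ (fun f hf => hf.1.1.continuous) fun f hf A B hAB =>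
      radialLE_of_hessian_entries_nonneg hf.1 (R := Set.univ)
        (fun x p _ => hf.2 x p.1 p.2) (fun i j => ?_) fun i j h1 _ => absurd (Set.mem_univ _) h1
    rw [← sub_nonneg, hentry hAB, sub_nonneg]
    exact h i j
  · have hne : ∀ i j, i ≠ j → Ωx i j = Ωy i j := fun i j hij => by
      rcases hij.lt_or_gt with hlt | hlt
      · exact h' i j hlt
      · rw [hsymm hX.posDef, hsymm hY.posDef, h' j i hlt]
    refine integralOrder_of_radialLE hX hY hδ (fun f hf => hf.1.1.continuous) fun f hf A B hAB =>
      radialLE_of_hessian_entries_nonneg hf.1 (R := {p | p.1 = p.2})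
        (fun x p hp => ?_) (fun i j => ?_) fun i j h1 _ => ?_
    · rw [← (show p.1 = p.2 from hp)]
      exact hf.2 x p.1
    · rw [← sub_nonneg, hentry hAB, sub_nonneg]
      rcases eq_or_ne i j with rfl | hij
      · exact h i
      · exact (hne i j hij).le
    · have := hentry hAB i j
      rw [hne i j h1] at this
      linarith
  · exact integralOrder_of_radialLE hX hY hδ (fun f hf => hf.1.continuous) fun f hf A B hAB =>
      radialLE_of_isCompletelyPositive_hessian hf.1 hf.2 (hAB ▸ h)
  · exact integralOrder_of_radialLE hX hY hδ (fun f hf => hf.1.continuous) fun f hf A B hAB =>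
      radialLE_of_isCopositive_hessian hf.1 hf.2 (hAB ▸ h)
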